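/- Consider the probabilistic asynchronous $\pi$-calculus with booleans, conditionals and an additional priority choice. The semantics of a process is a probabilistic automaton: in each state a transition group (a discrete probability distribution on pairs (action, next state)) is selected nondeterministically by an adversary, and the transition within the group is selected probabilistically. In a probabilistic choice $\sum_i p_i\,\alpha_i.P_i$ all branches form one group; an output may synchronize with the matching inputs of a group of a parallel process, the other transitions of that group being kept; a restriction $\nu y$ drops the transitions whose actions have $y$ as a free name and renormalizes the probabilities of the remaining ones. In a priority choice $x(b).P \triangleright \tau.Q$ the first branch is selected if its prefix is enabled, i.e. if an unguarded output on $x$ is available in the rest of the system, and the second branch $\tau.Q$ can be selected only if no such output is available. Consider the process $\nu x_0\,\nu x_1\,(P_0 \mid P_1)$, where, for $i\in\{0,1\}$ and with $\oplus$ the sum modulo $2$, $$P_i \;=\; \bar x_i\langle \mathbf t\rangle \;\mid\; \mathit{rec}_X\Bigl(\tfrac12\,\tau.B_{i,i} + \tfrac12\,\tau.B_{i,i\oplus 1}\Bigr),$$ $$B_{i,j} \;=\; x_j(b).\ \mathit{if}\ b\ \mathit{then}\ \bigl(x_{j\oplus1}(b).(\bar o_i\langle i\rangle \mid \bar x_j\langle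 \mathbf f\rangle)\ \triangleright\ \tau.(\bar x_j\langle \mathbf t\rangle \mid X)\bigr)\ \mathit{else}\ \bar o_i\langle i\oplus 1\rangle .$$ A random draw $(i,j)$ is the $\tau$-transition of $P_i$ that selects the branch $B_{i,j}$ of the blind choice $\tfrac12\,\tau.B_{i,i} + \tfrac12\,\tau.B_{i,i\oplus1}$. An adversary selects, at each node of the unfolding tree of the automaton (hence depending on the whole history, including the earlier random choices), one of the transition groups allowed in the state of that node, whenever there is one; the executions under the adversary carry the probability measure that gives to the set of all executions extending a finite path the product of the transition probabilities along this path. Then, for every $n\ge 2$ and under every adversary, the probability of the executions of $\nu x_0\,\nu x_1\,(P_0\mid P_1)$ that contain at least $n$ random draws is at most $1/2^{\,n-2}$. -/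

import Mathlib

open MeasureTheory ProbabilityTheory
open scoped ENNReal

/-! ## Probabilistic automata, adversaries, executions -/

/-- A probabilistic automaton on states `S` and actions `A`: an initial state, and for every state
the set of its transition groups. A transition group is a discrete probability distribution on
`A × S`; deadlock is the absence of transition groups. -/
structure ProbAutomaton (S A : Type) where
  init : S
  trans : S → Set (PMF (A × S))

/-- The nodes of the unfolding tree: the root, and for every node `n` a child for each transition
`(a, s)` of each group `g`, labeled by the state `s`. A node determines the path leading to it. -/
inductive Node (S A : Type) : Type
  | root
  | child (n : Node S A) (g : PMF (A × S)) (a : A) (s : S)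

instance (S A : Type) : MeasurableSpace (Node S A) := ⊤

namespace ProbAutomaton

variable {S A : Type}

/-- The state that labels a node. -/
def state (M : ProbAutomaton S A) : Node S A → S
  | Node.root => M.init
  | Node.child _ _ _ s => s

/-- An adversary selects at every node one of the transition groups that are allowed in the state of
the node; it selects nothing only at a node whose state is deadlocked. -/
structure Adversary (M : ProbAutomaton S A) where
  choose : Node S A → Option (PMF (A × S))
  mem_trans : ∀ n g, choose n = some g → g ∈ M.trans (M.state n)
  eq_none : ∀ n, choose n = none → M.trans (M.state n) = ∅

namespace Adversary

variable {M : ProbAutomaton S A}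

/-- One step of the execution tree: from a node to its children within the selected group, with the
probabilities of that group. A finite maximal path is continued by repeating its last node. -/
noncomputable def next (ζ : M.Adversary) (n : Node S A) : PMF (Node S A) :=
  match ζ.choose n with
  | none => PMF.pure n
  | some g => g.map fun a => n.child g a.1 a.2

/-- The step of the execution tree as a Markov kernel from the first `t + 1` nodes of a path to
the node that comes next. -/
noncomputable def stepKernel (ζ : M.Adversary) (t : ℕ) :
    Kernel (Finset.Iic t → Node S A) (Node S A) :=
  Kernel.comap (⟨fun n => (ζ.next n).toMeasure, measurable_from_top⟩ : Kernel (Node S A) (Node S A))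
    (fun ω => ω ⟨t, Finset.mem_Iic.2 le_rfl⟩) (measurable_pi_apply _)

instance (ζ : M.Adversary) (t : ℕ) : IsMarkovKernel (ζ.stepKernel t) :=
  ⟨fun ω => PMF.toMeasure.isProbabilityMeasure (ζ.next (ω ⟨t, Finset.mem_Iic.2 le_rfl⟩))⟩

/-- The probability measure on the executions under `ζ`, an execution being the sequence of the
nodes that it visits, from the root on. The cone of the executions that extend a finite path has as
its measure the product of the probabilities along that path. -/
noncomputable def execMeasure (ζ : M.Adversary) : Measure (ℕ → Node S A) :=
  Kernel.traj (X := fun _ => Node S A) ζ.stepKernel 0 (fun _ => Node.root)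

end Adversary

end ProbAutomaton

/-! ## The probabilistic asynchronous π-calculus with a priority choice

Bound names and process variables are de Bruijn indices, so that alpha-convertible processes
are equal. -/

/-- Names. `var k` is the name bound by the `k`-th enclosing binder (or a free name if there is no
such binder); `chan k` are global channel names; `bool b` are the values **t** and **f**; `num k`
are the values that name a process. -/
inductive Name : Type
  | var (k : ℕ)
  | chan (k : ℕ)
  | bool (b : Bool)
  | num (k : ℕ)
  deriving DecidableEq

namespace Name

/-- Simultaneous substitution of names for the indices. -/
def subst (σ : ℕ → Name) : Name → Name
  | var k => σ k
  | x => x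

/-- Passage under one more name binder. -/
def shift : Name → Name := subst fun k => var (k + 1)

/-- Passage out of a name binder, for names other than `var 0`. -/
def lower : Name → Name := subst fun k => var (k - 1)

/-- The substitution `σ` under one more name binder. -/
def liftSubst (σ : ℕ → Name) : ℕ → Name
  | 0 => var 0
  | k + 1 => (σ k).shift

/-- The substitution that replaces the innermost bound name by `y` and removes its binder. -/
def inst (y : Name) : ℕ → Name
  | 0 => y
  | k + 1 => var k

/-- The substitution that exchanges the two innermost bound names. -/
def swap : ℕ → Name
  | 0 => var 1
  | 1 => var 0
  | k + 2 => var (k + 2)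

end Name

/-- A random draw `(i, j)`: process `i` selects channel `j`. Arithmetic in `Fin 2` is modulo 2. -/
abbrev Draw : Type := Fin 2 × Fin 2

/-- Prefixes: the input `x(y)`, which binds a name in its continuation, and the silent prefix. A
silent prefix may carry the random draw it stands for, so that draws can be told from the other
silent steps. -/
inductive Prefix : Type
  | inp (x : Name)
  | tau (d : Option Draw)

/-- Actions: input `x(y)`, free output, bound output `x̄(y)`, and silent action. Input and bound
output bind a name in the process that is reached. -/
inductive Act : Type
  | inp (x : Name)
  | out (x y : Name)
  | bout (x : Name)
  | tau (d : Option Draw)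

namespace Prefix

def subst (σ : ℕ → Name) : Prefix → Prefix
  | inp x => inp (x.subst σ)
  | tau d => tau d

/-- The substitution `σ`, as it acts on the continuation of the prefix. -/
def liftSubst (σ : ℕ → Name) : Prefix → ℕ → Name
  | inp _ => Name.liftSubst σ
  | tau _ => σ

def toAct : Prefix → Act
  | inp x => Act.inp x
  | tau d => Act.tau d

end Prefix

namespace Act

/-- The name `x` occurs free in the action. -/
def HasFree (x : Name) : Act → Prop
  | inp y => x = y
  | out y z => x = y ∨ x = z
  | bout y => x = y
  | tau _ => False

def lower : Act → Act
  | inp x => inp x.lower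
  | out x y => out x.lower y.lower
  | bout x => bout x.lower
  | tau d => tau d

end Act

/-- Processes.
* `nil`: inaction, the empty sum;
* `out x y`: asynchronous output of `y` on `x`;
* `sum w α P`: the probabilistic choice `∑ i, w i · α i . P i` (a branch of weight 0 is never
  a transition, it is as if it were absent);
* `nu P`: restriction, which binds a name in `P`;
* `par P Q`: parallel composition;
* `pvar k`, `recu P`: process variables and recursion, `recu P` binds a process variable in `P`;
* `ite b P Q`: `if b then P else Q`;
* `prio x P Q`: the priority choice between `x(y).P`, where `y` is bound in `P`, and `τ.Q`: the
  first branch is selected if its prefix is enabled, the second one otherwise. -/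
inductive Proc : Type
  | nil
  | out (x y : Name)
  | sum {m : ℕ} (w : PMF (Fin m)) (α : Fin m → Prefix) (P : Fin m → Proc)
  | nu (P : Proc)
  | par (P Q : Proc)
  | pvar (k : ℕ)
  | recu (P : Proc)
  | ite (b : Name) (P Q : Proc)
  | prio (x : Name) (P Q : Proc)

namespace Proc

/-- Simultaneous substitution of names for the free indices. -/
def subst : (ℕ → Name) → Proc → Proc
  | _, nil => nil
  | σ, out x y => out (x.subst σ) (y.subst σ)
  | σ, sum w α P => sum w (fun i => (α i).subst σ) (fun i => (P i).subst ((α i).liftSubst σ))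
  | σ, nu P => nu (P.subst (Name.liftSubst σ))
  | σ, par P Q => par (P.subst σ) (Q.subst σ)
  | _, pvar k => pvar k
  | σ, recu P => recu (P.subst σ)
  | σ, ite b P Q => ite (b.subst σ) (P.subst σ) (Q.subst σ)
  | σ, prio x P Q => prio (x.subst σ) (P.subst (Name.liftSubst σ)) (Q.subst σ)

/-- Passage under one more name binder. -/
def shift : Proc → Proc := subst fun k => Name.var (k + 1)

/-- Passage into the scope of the name that the action binds, if it binds one. -/
def under : Act → Proc → Proc
  | Act.inp _, P => P.shift
  | Act.bout _, P => P.shift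
  | _, P => P

/-- Passage of a process into the scope of a prefix. -/
def underPrefix (α : Prefix) (P : Proc) : Proc := P.under α.toAct

/-- Renaming of the free process variables. -/
def prename : (ℕ → ℕ) → Proc → Proc
  | _, nil => nil
  | _, out x y => out x y
  | ρ, sum w α P => sum w α (fun i => (P i).prename ρ)
  | ρ, nu P => nu (P.prename ρ)
  | ρ, par P Q => par (P.prename ρ) (Q.prename ρ)
  | ρ, pvar k => pvar (ρ k)
  | ρ, recu P => recu (P.prename fun k => Nat.casesOn k 0 fun j => ρ j + 1)
  | ρ, ite b P Q => ite b (P.prename ρ) (Q.prename ρ)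
  | ρ, prio x P Q => prio x (P.prename ρ) (Q.prename ρ)

/-- Simultaneous, capture-avoiding substitution of processes for the free process variables. -/
def psubst : (ℕ → Proc) → Proc → Proc
  | _, nil => nil
  | _, out x y => out x y
  | θ, sum w α P => sum w α (fun i => (P i).psubst fun k => (θ k).underPrefix (α i))
  | θ, nu P => nu (P.psubst fun k => (θ k).shift)
  | θ, par P Q => par (P.psubst θ) (Q.psubst θ)
  | θ, pvar k => θ k
  | θ, recu P => recu (P.psubst fun k => Nat.casesOn k (pvar 0) fun j => (θ j).prename Nat.succ)
  | θ, ite b P Q => ite b (P.psubst θ) (Q.psubst θ)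
  | θ, prio x P Q => prio x (P.psubst fun k => (θ k).shift) (Q.psubst θ)

/-- The body `P` of a recursion, with the recursive process itself for the variable it binds. -/
def unfold (P : Proc) : Proc := P.psubst fun k => Nat.casesOn k (recu P) pvar

/-- All the occurrences of the process variable `k` are prefixed. -/
def Guarded : ℕ → Proc → Prop
  | _, nil => True
  | _, out _ _ => True
  | _, sum _ _ _ => True
  | k, nu P => P.Guarded k
  | k, par P Q => P.Guarded k ∧ Q.Guarded k
  | k, pvar j => j ≠ k
  | k, recu P => P.Guarded (k + 1)
  | k, ite _ P Q => P.Guarded k ∧ Q.Guarded k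
  | _, prio _ _ _ => True

/-- Structural congruence: the least congruence that contains the commutativity of the parallel
operator, the unfolding of recursion, and the rules of the conditional. Recursion is formed on
guarded bodies only. -/
inductive Cong : Proc → Proc → Prop
  | refl (P) : Cong P P
  | symm {P Q} : Cong P Q → Cong Q P
  | trans {P Q R} : Cong P Q → Cong Q R → Cong P R
  | par_comm (P Q) : Cong (par P Q) (par Q P)
  | recu_unfold (P) : Cong (recu P) P.unfold
  | ite_true (P Q) : Cong (ite (Name.bool true) P Q) P
  | ite_false (P Q) : Cong (ite (Name.bool false) P Q) Q
  | sum {m : ℕ} (w : PMF (Fin m)) (α) {P Q : Fin m → Proc} :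
      (∀ i, Cong (P i) (Q i)) → Cong (sum w α P) (sum w α Q)
  | nu {P Q} : Cong P Q → Cong (nu P) (nu Q)
  | par {P P' Q Q'} : Cong P P' → Cong Q Q' → Cong (par P Q) (par P' Q')
  | recu {P Q} : P.Guarded 0 → Q.Guarded 0 → Cong P Q → Cong (recu P) (recu Q)
  | ite (b) {P P' Q Q'} : Cong P P' → Cong Q Q' → Cong (ite b P Q) (ite b P' Q')
  | prio (x) {P P' Q Q'} : Cong P P' → Cong Q Q' → Cong (prio x P Q) (prio x P' Q')

/-- The process offers an output on `x`: it has an unguarded output on that name. -/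
inductive Offers : Proc → Name → Prop
  | out (x y) : Offers (out x y) x
  | nu {P x} : Offers P x.shift → Offers (nu P) x
  | par_left {P Q x} : Offers P x → Offers (par P Q) x
  | par_right {P Q x} : Offers Q x → Offers (par P Q) x
  | recu {P x} : Offers P.unfold x → Offers (recu P) x
  | ite_true {P Q x} : Offers P x → Offers (ite (Name.bool true) P Q) x
  | ite_false {P Q x} : Offers Q x → Offers (ite (Name.bool false) P Q) x

/-- A transition of `P` that `P | Q` inherits. -/
def parTarget (Q : Proc) (a : Act × Proc) : Act × Proc := (a.1, par a.2 (Q.under a.1))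

/-- A transition of `P` that `ν P` inherits. -/
def resTarget : Act × Proc → Act × Proc
  | (Act.inp x, P) => (Act.inp x.lower, nu (P.subst Name.swap))
  | (Act.bout x, P) => (Act.bout x.lower, nu (P.subst Name.swap))
  | (μ, P) => (μ.lower, nu P)

/-- A transition of `Q` in the group of `P | Q` in which `P` offers `x̄y` and then becomes `P'`. -/
def comTarget (P P' : Proc) (x y : Name) : Act × Proc → Act × Proc
  | (Act.inp z, Q) => if z = x then (Act.tau none, par P' (Q.subst (Name.inst y)))
      else (Act.inp z, par P.shift Q)
  | (μ, Q) => (μ, par (P.under μ) Q)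

/-- A transition of `Q` in the group of `P | Q` in which `P` offers a private name on `x` and then
becomes `P'`. -/
def closeTarget (P P' : Proc) (x : Name) : Act × Proc → Act × Proc
  | (Act.inp z, Q) => if z = x then (Act.tau none, nu (par P' Q))
      else (Act.inp z, par P.shift Q)
  | (μ, Q) => (μ, par (P.under μ) Q)

/-- `Step E P g`: `g` is a transition group of `P` when `E` is the set of the names on which the
rest of the system offers an output. The set `E` only matters for the second branch of a priority
choice, which can be selected only if no output is available for the first one.

In `res` the transitions on the restricted name are dropped and the probability is redistributed
among the others (`PMF.filter` normalizes). -/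
inductive Step : Set Name → Proc → PMF (Act × Proc) → Prop
  | sum (E) {m : ℕ} (w : PMF (Fin m)) (α P) :
      Step E (sum w α P) (w.map fun i => ((α i).toAct, P i))
  | out (E x y) : Step E (out x y) (PMF.pure (Act.out x y, nil))
  | prio_inp (E x P Q) : Step E (prio x P Q) (PMF.pure (Act.inp x, P))
  | prio_tau {E x} (P Q) : x ∉ E → Step E (prio x P Q) (PMF.pure (Act.tau none, Q))
  | opn {E P P' x} : x ≠ Name.var 0 →
      Step (Name.shift '' E) P (PMF.pure (Act.out x (Name.var 0), P')) →
      Step E (nu P) (PMF.pure (Act.bout x.lower, P'))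
  | res {E P g} (h : ∃ a ∈ {a : Act × Proc | ¬ a.1.HasFree (Name.var 0)}, a ∈ g.support) :
      Step (Name.shift '' E) P g →
      Step E (nu P) ((g.filter {a : Act × Proc | ¬ a.1.HasFree (Name.var 0)} h).map resTarget)
  | par {E P Q g} : Step (E ∪ {x | Q.Offers x}) P g →
      Step E (par P Q) (g.map (parTarget Q))
  | com {E P P' Q g x y} :
      Step (E ∪ {x | Q.Offers x}) P (PMF.pure (Act.out x y, P')) →
      Step (E ∪ {x | P.Offers x}) Q g →
      Step E (par P Q) (g.map (comTarget P P' x y))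
  | close {E P P' Q g x} :
      Step (E ∪ {x | Q.Offers x}) P (PMF.pure (Act.bout x, P')) →
      Step (E ∪ {x | P.Offers x}) Q g →
      Step E (par P Q) (g.map (closeTarget P P' x))
  | cong {E P P' g} (f : Act × Proc → Proc) : Cong P P' → Step E P' g →
      (∀ a ∈ g.support, Cong a.2 (f a)) →
      Step E P (g.map fun a => (a.1, f a))

/-- The probabilistic automaton of a process. -/
def automaton (P : Proc) : ProbAutomaton Proc Act where
  init := P
  trans := fun Q => {g | Step ∅ Q g}

/-- The process `α.P`. -/
noncomputable def pre (α : Prefix) (P : Proc) : Proc :=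
  sum (PMF.pure (0 : Fin 1)) (fun _ => α) (fun _ => P)

end Proc

/-! ## The election algorithm -/

namespace Election

open Proc

/-- The channels `x₀` and `x₁` in the scope of `ν x₀ ν x₁`. -/
def x : Fin 2 → Name
  | 0 => Name.var 1
  | 1 => Name.var 0

/-- The channel `o i` on which process `i` announces the leader. -/
def o (i : Fin 2) : Name := Name.chan i

/-- What process `i` does after it has selected channel `j`, the process variable `X` being `pvar 0`:
`x_j(b). if b then (x_{j⊕1}(b).(ō_i⟨i⟩ | x̄_j⟨f⟩) or else τ.(x̄_j⟨t⟩ | X)) else ō_i⟨i⊕1⟩`,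
where "or else" is the priority choice. -/
noncomputable def branch (i j : Fin 2) : Proc :=
  pre (Prefix.inp (x j)) <|
    ite (Name.var 0)
      (prio (x (j + 1)).shift
        (par (out (o i) (Name.num i)) (out (x j).shift.shift (Name.bool false)))
        (par (out (x j).shift (Name.bool true)) (pvar 0)))
      (out (o i) (Name.num ((i + 1 : Fin 2) : ℕ)))

/-- The process `P_i = x̄_i⟨t⟩ | rec_X (1/2 τ. branch i i + 1/2 τ. branch i (i ⊕ 1))`. -/
noncomputable def node (i : Fin 2) : Proc :=
  par (out (x i) (Name.bool true))
    (recu (sum (PMF.uniformOfFintype (Fin 2))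
      (fun k => Prefix.tau (some (i, i + k))) (fun k => branch i (i + k))))

/-- The network `ν x₀ ν x₁ (P₀ | P₁)`. -/
noncomputable def network : Proc := nu (nu (par (node 0) (node 1)))

/-- The number of random draws on the path that leads to a node. -/
def draws : Node Proc Act → ℕ
  | Node.root => 0
  | Node.child n _ (Act.tau (some _)) _ => draws n + 1
  | Node.child n _ _ _ => draws n

end Election

/-!
Up to structural congruence, every process that the network reaches consists, under the two
restrictions, of a few components: the messages on `x₀` and `x₁`, and each of the two processes in
one of three phases. If both processes have drawn the same channel, then the one that takes the
message on it finds the other message still there; it wins, and nothing is drawn any more. This is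
the state of affairs with probability at least `1/2` after every draw but the first one, whatever
the adversary does. Hence a bound that depends on the number of draws still missing and on the
distance of the current state from that situation is a supermartingale along the executions. It is
at least `1` as soon as enough draws have been made, and the number of draws never decreases, so
the supermartingale bounds the probability in question.
-/

/-! ## Substitutions -/

namespace Name

theorem subst_subst (σ τ : ℕ → Name) (x : Name) :
    (x.subst σ).subst τ = x.subst fun k => (σ k).subst τ := by
  cases x <;> rfl

theorem subst_var (x : Name) : x.subst var = x := by
  cases x <;> rfl

theorem liftSubst_var : liftSubst var = var := by
  funext k; cases k <;> rfl

theorem shift_subst_liftSubst (σ : ℕ → Name) (x : Name) :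
    x.shift.subst (liftSubst σ) = (x.subst σ).shift := by
  simp only [shift, subst_subst]; rfl

theorem liftSubst_comp (σ τ : ℕ → Name) :
    (fun k => (liftSubst σ k).subst (liftSubst τ)) = liftSubst fun k => (σ k).subst τ := by
  funext k
  cases k with
  | zero => rfl
  | succ k => exact shift_subst_liftSubst τ (σ k)

theorem shift_subst_inst (x y : Name) : x.shift.subst (inst y) = x :=
  (subst_subst _ _ x).trans (subst_var x)

end Name

namespace Prefix

theorem liftSubst_var (α : Prefix) : α.liftSubst Name.var = Name.var := by
  cases α
  · exact Name.liftSubst_var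
  · rfl

theorem liftSubst_comp (α : Prefix) (σ τ : ℕ → Name) :
    (fun k => (α.liftSubst σ k).subst ((α.subst σ).liftSubst τ)) =
      α.liftSubst fun k => (σ k).subst τ := by
  cases α
  · exact Name.liftSubst_comp σ τ
  · rfl

theorem subst_subst (α : Prefix) (σ τ : ℕ → Name) :
    (α.subst σ).subst τ = α.subst fun k => (σ k).subst τ := by
  cases α <;> simp [subst, Name.subst_subst]

theorem subst_var (α : Prefix) : α.subst Name.var = α := by
  cases α <;> simp [subst, Name.subst_var]

end Prefix

namespace Proc

theorem subst_subst (P : Proc) (σ τ : ℕ → Name) :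
    (P.subst σ).subst τ = P.subst fun k => (σ k).subst τ := by
  induction P generalizing σ τ <;>
    simp_all [subst, Name.subst_subst, Name.liftSubst_comp, Prefix.subst_subst,
      Prefix.liftSubst_comp]

theorem subst_var (P : Proc) : P.subst Name.var = P := by
  induction P <;>
    simp_all [subst, Name.subst_var, Name.liftSubst_var, Prefix.liftSubst_var, Prefix.subst_var]

theorem shift_subst_liftSubst (P : Proc) (σ : ℕ → Name) :
    P.shift.subst (Name.liftSubst σ) = (P.subst σ).shift := by
  simp only [shift, subst_subst, Name.liftSubst, Name.subst, Name.shift]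

theorem shift_subst_inst (P : Proc) (y : Name) : P.shift.subst (Name.inst y) = P :=
  (subst_subst P _ _).trans (subst_var P)

theorem underPrefix_subst (α : Prefix) (P : Proc) (σ : ℕ → Name) :
    (P.underPrefix α).subst (α.liftSubst σ) = (P.subst σ).underPrefix (α.subst σ) := by
  cases α
  · exact shift_subst_liftSubst P σ
  · rfl

theorem prename_subst (P : Proc) (ρ : ℕ → ℕ) (σ : ℕ → Name) :
    (P.prename ρ).subst σ = (P.subst σ).prename ρ := by
  induction P generalizing ρ σ <;> simp_all [subst, prename]

theorem shift_prename (P : Proc) (ρ : ℕ → ℕ) : P.shift.prename ρ = (P.prename ρ).shift :=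
  (prename_subst P ρ _).symm

theorem underPrefix_prename (α : Prefix) (P : Proc) (ρ : ℕ → ℕ) :
    (P.underPrefix α).prename ρ = (P.prename ρ).underPrefix α := by
  cases α
  · exact shift_prename P ρ
  · rfl

/-- The renaming `ρ` of process variables under one more binder. It names the function that occurs
in `Proc.prename`. -/
def liftRename (ρ : ℕ → ℕ) : ℕ → ℕ := fun k => Nat.casesOn k 0 fun j => ρ j + 1

/-- The substitution `θ` of processes under one more binder of a process variable. It names the
function that occurs in `Proc.psubst`. -/
def liftProc (θ : ℕ → Proc) : ℕ → Proc :=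
  fun k => Nat.casesOn k (pvar 0) fun j => (θ j).prename Nat.succ

/-- The substitution that replaces the innermost bound process variable by `P` and removes its
binder. It names the function that occurs in `Proc.unfold`. -/
def instProc (P : Proc) : ℕ → Proc := fun k => Nat.casesOn k P pvar

theorem prename_recu (ρ : ℕ → ℕ) (P : Proc) :
    (recu P).prename ρ = recu (P.prename (liftRename ρ)) := rfl

theorem psubst_recu (θ : ℕ → Proc) (P : Proc) :
    (recu P).psubst θ = recu (P.psubst (liftProc θ)) := rfl

theorem unfold_eq_psubst (P : Proc) : P.unfold = P.psubst (instProc (recu P)) := rfl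

theorem prename_prename (P : Proc) (ρ ρ' : ℕ → ℕ) :
    (P.prename ρ).prename ρ' = P.prename fun k => ρ' (ρ k) := by
  induction P generalizing ρ ρ' with
  | recu P ih =>
    simp only [prename_recu, ih]
    congr 2
    funext k; cases k <;> rfl
  | _ => simp_all [prename]

theorem psubst_prename (P : Proc) (ρ : ℕ → ℕ) (θ : ℕ → Proc) :
    (P.prename ρ).psubst θ = P.psubst fun k => θ (ρ k) := by
  induction P generalizing ρ θ with
  | recu P ih =>
    simp only [prename_recu, psubst_recu, ih]
    congr 2
    funext k; cases k <;> rfl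
  | _ => simp_all [prename, psubst]

theorem prename_psubst (P : Proc) (ρ : ℕ → ℕ) (θ : ℕ → Proc) :
    (P.psubst θ).prename ρ = P.psubst fun k => (θ k).prename ρ := by
  induction P generalizing ρ θ with
  | recu P ih =>
    simp only [prename_recu, psubst_recu, ih]
    congr 2
    funext k
    cases k with
    | zero => rfl
    | succ k => simp only [liftProc, liftRename, prename_prename]
  | _ => simp_all [prename, psubst, shift_prename, underPrefix_prename]

theorem underPrefix_pvar (α : Prefix) (k : ℕ) : (pvar k).underPrefix α = pvar k := by
  cases α <;> rfl

theorem liftProc_pvar : liftProc pvar = pvar := by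
  funext k; cases k <;> rfl

theorem psubst_pvar (P : Proc) : P.psubst pvar = P := by
  induction P with
  | recu P ih => rw [psubst_recu, liftProc_pvar, ih]
  | sum w α P ih => simp only [psubst, underPrefix_pvar, ih]
  | nu P ih => exact congrArg nu ih
  | prio x P Q ihP ihQ => exact congrArg₂ (prio x) ihP ihQ
  | _ => simp_all [psubst]

theorem prename_eq_psubst (P : Proc) (ρ : ℕ → ℕ) :
    P.prename ρ = P.psubst fun k => pvar (ρ k) := by
  rw [← psubst_prename, psubst_pvar]

theorem subst_psubst (P : Proc) (σ : ℕ → Name) (θ : ℕ → Proc) :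
    (P.psubst θ).subst σ = (P.subst σ).psubst fun k => (θ k).subst σ := by
  induction P generalizing σ θ with
  | recu P ih =>
    simp only [psubst_recu, subst, ih]
    congr 2
    funext k
    cases k with
    | zero => rfl
    | succ k => simp only [liftProc, prename_subst]
  | _ => simp_all [psubst, subst, shift_subst_liftSubst, underPrefix_subst]

theorem shift_psubst (P : Proc) (θ : ℕ → Proc) :
    P.shift.psubst (fun k => (θ k).shift) = (P.psubst θ).shift :=
  (subst_psubst P _ θ).symm

theorem underPrefix_psubst (α : Prefix) (P : Proc) (θ : ℕ → Proc) :
    (P.underPrefix α).psubst (fun k => (θ k).underPrefix α) = (P.psubst θ).underPrefix α := by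
  cases α
  · exact shift_psubst P θ
  · rfl

theorem psubst_psubst (P : Proc) (θ θ' : ℕ → Proc) :
    (P.psubst θ).psubst θ' = P.psubst fun k => (θ k).psubst θ' := by
  induction P generalizing θ θ' with
  | recu P ih =>
    simp only [psubst_recu, ih]
    congr 2
    funext k
    cases k with
    | zero => rfl
    | succ k => simp only [liftProc, psubst_prename, prename_psubst]
  | _ => simp_all [psubst, shift_psubst, underPrefix_psubst]

theorem unfold_subst (P : Proc) (σ : ℕ → Name) : P.unfold.subst σ = (P.subst σ).unfold := by
  rw [unfold_eq_psubst, unfold_eq_psubst, subst_psubst]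
  congr 1
  funext k; cases k <;> rfl

theorem unfold_psubst (P : Proc) (θ : ℕ → Proc) :
    P.unfold.psubst θ = (P.psubst (liftProc θ)).unfold := by
  rw [unfold_eq_psubst, unfold_eq_psubst, psubst_psubst, psubst_psubst]
  congr 1
  funext k
  cases k with
  | zero => rfl
  | succ k =>
    exact (psubst_pvar (θ k)).symm.trans
      (psubst_prename (θ k) Nat.succ (instProc (recu (P.psubst (liftProc θ))))).symm

/-! ## Structural congruence without the guardedness condition -/

/-- Structural congruence in which recursion may be formed on arbitrary bodies. Unlike `Cong` it is
visibly stable under the substitution of processes, for no guards have to be tracked. -/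
inductive UCong : Proc → Proc → Prop
  | refl (P) : UCong P P
  | symm {P Q} : UCong P Q → UCong Q P
  | trans {P Q R} : UCong P Q → UCong Q R → UCong P R
  | par_comm (P Q) : UCong (par P Q) (par Q P)
  | recu_unfold (P) : UCong (recu P) P.unfold
  | ite_true (P Q) : UCong (ite (Name.bool true) P Q) P
  | ite_false (P Q) : UCong (ite (Name.bool false) P Q) Q
  | sum {m : ℕ} (w : PMF (Fin m)) (α) {P Q : Fin m → Proc} :
      (∀ i, UCong (P i) (Q i)) → UCong (sum w α P) (sum w α Q)
  | nu {P Q} : UCong P Q → UCong (nu P) (nu Q)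
  | par {P P' Q Q'} : UCong P P' → UCong Q Q' → UCong (par P Q) (par P' Q')
  | recu {P Q} : UCong P Q → UCong (recu P) (recu Q)
  | ite (b) {P P' Q Q'} : UCong P P' → UCong Q Q' → UCong (ite b P Q) (ite b P' Q')
  | prio (x) {P P' Q Q'} : UCong P P' → UCong Q Q' → UCong (prio x P Q) (prio x P' Q')

theorem Cong.uCong {P Q : Proc} (h : Cong P Q) : UCong P Q := by
  induction h with
  | refl P => exact .refl P
  | symm _ ih => exact .symm ih
  | trans _ _ ih₁ ih₂ => exact .trans ih₁ ih₂
  | par_comm P Q => exact .par_comm P Q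
  | recu_unfold P => exact .recu_unfold P
  | ite_true P Q => exact .ite_true P Q
  | ite_false P Q => exact .ite_false P Q
  | sum w α _ ih => exact .sum w α ih
  | nu _ ih => exact .nu ih
  | par _ _ ih₁ ih₂ => exact .par ih₁ ih₂
  | recu _ _ _ ih => exact .recu ih
  | ite b _ _ ih₁ ih₂ => exact .ite b ih₁ ih₂
  | prio x _ _ ih₁ ih₂ => exact .prio x ih₁ ih₂

namespace UCong

theorem subst {P Q : Proc} (h : UCong P Q) (σ : ℕ → Name) : UCong (P.subst σ) (Q.subst σ) := by
  induction h generalizing σ with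
  | refl P => exact .refl _
  | symm _ ih => exact .symm (ih σ)
  | trans _ _ ih₁ ih₂ => exact .trans (ih₁ σ) (ih₂ σ)
  | par_comm P Q => exact .par_comm _ _
  | recu_unfold P => rw [unfold_subst]; exact .recu_unfold _
  | ite_true P Q => exact .ite_true _ _
  | ite_false P Q => exact .ite_false _ _
  | sum w α _ ih => exact .sum w _ fun i => ih i _
  | nu _ ih => exact .nu (ih _)
  | par _ _ ih₁ ih₂ => exact .par (ih₁ σ) (ih₂ σ)
  | recu _ ih => exact .recu (ih σ)
  | ite b _ _ ih₁ ih₂ => exact .ite _ (ih₁ σ) (ih₂ σ)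
  | prio x _ _ ih₁ ih₂ => exact .prio _ (ih₁ _) (ih₂ σ)

theorem underPrefix {P Q : Proc} (h : UCong P Q) (α : Prefix) :
    UCong (P.underPrefix α) (Q.underPrefix α) := by
  cases α
  · exact h.subst _
  · exact h

theorem psubst {P Q : Proc} (h : UCong P Q) (θ : ℕ → Proc) :
    UCong (P.psubst θ) (Q.psubst θ) := by
  induction h generalizing θ with
  | refl P => exact .refl _
  | symm _ ih => exact .symm (ih θ)
  | trans _ _ ih₁ ih₂ => exact .trans (ih₁ θ) (ih₂ θ)
  | par_comm P Q => exact .par_comm _ _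
  | recu_unfold P => rw [unfold_psubst]; exact .recu_unfold _
  | ite_true P Q => exact .ite_true _ _
  | ite_false P Q => exact .ite_false _ _
  | sum w α _ ih => exact .sum w _ fun i => ih i _
  | nu _ ih => exact .nu (ih _)
  | par _ _ ih₁ ih₂ => exact .par (ih₁ θ) (ih₂ θ)
  | recu _ ih => exact .recu (ih _)
  | ite b _ _ ih₁ ih₂ => exact .ite _ (ih₁ θ) (ih₂ θ)
  | prio x _ _ ih₁ ih₂ => exact .prio _ (ih₁ _) (ih₂ θ)

theorem prename {P Q : Proc} (h : UCong P Q) (ρ : ℕ → ℕ) :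
    UCong (P.prename ρ) (Q.prename ρ) := by
  simpa only [prename_eq_psubst] using h.psubst _

theorem psubst_of_forall (P : Proc) {θ θ' : ℕ → Proc} (h : ∀ k, UCong (θ k) (θ' k)) :
    UCong (P.psubst θ) (P.psubst θ') := by
  induction P generalizing θ θ' with
  | nil => exact .refl _
  | out x y => exact .refl _
  | sum w α P ih => exact .sum w _ fun i => ih i fun k => (h k).underPrefix _
  | nu P ih => exact .nu (ih fun k => (h k).subst _)
  | par P Q ihP ihQ => exact .par (ihP h) (ihQ h)
  | pvar k => exact h k
  | recu P ih =>
    refine .recu (ih fun k => ?_)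
    cases k with
    | zero => exact .refl _
    | succ k => exact (h k).prename _
  | ite b P Q ihP ihQ => exact .ite _ (ihP h) (ihQ h)
  | prio x P Q ihP ihQ => exact .prio _ (ihP fun k => (h k).subst _) (ihQ h)

theorem psubst_congr {P Q : Proc} (h : UCong P Q) {θ θ' : ℕ → Proc}
    (hθ : ∀ k, UCong (θ k) (θ' k)) : UCong (P.psubst θ) (Q.psubst θ') :=
  (h.psubst θ).trans (psubst_of_forall Q hθ)

end UCong

end Proc

/-! ## Heads -/

namespace Proc

/-- Head evaluation: after `n` unfoldings of recursions and conditionals at its head, `P` becomes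
`h`, which is an output, a sum, a restriction, a parallel composition or a priority choice. The
number `n` is what makes recursion on unguarded bodies tractable: see `HeadSim.recu`. -/
inductive HeadEval : ℕ → Proc → Proc → Prop
  | out (x y) : HeadEval 0 (out x y) (out x y)
  | sum {m : ℕ} (w : PMF (Fin m)) (α P) : HeadEval 0 (sum w α P) (sum w α P)
  | nu (P) : HeadEval 0 (nu P) (nu P)
  | par (P Q) : HeadEval 0 (par P Q) (par P Q)
  | prio (x P Q) : HeadEval 0 (prio x P Q) (prio x P Q)
  | recu {n P h} : HeadEval n P.unfold h → HeadEval (n + 1) (recu P) h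
  | ite_true {n P Q h} : HeadEval n P h → HeadEval (n + 1) (ite (Name.bool true) P Q) h
  | ite_false {n P Q h} : HeadEval n Q h → HeadEval (n + 1) (ite (Name.bool false) P Q) h

/-- Congruence of heads: the same outermost operator, applied to congruent processes. -/
inductive HeadCong : Proc → Proc → Prop
  | out (x y) : HeadCong (out x y) (out x y)
  | sum {m : ℕ} (w : PMF (Fin m)) (α) {P Q : Fin m → Proc} :
      (∀ i, UCong (P i) (Q i)) → HeadCong (sum w α P) (sum w α Q)
  | nu {P Q} : UCong P Q → HeadCong (nu P) (nu Q)
  | par {P P' Q Q'} : UCong P P' → UCong Q Q' → HeadCong (par P Q) (par P' Q')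
  | par_swap {P P' Q Q'} : UCong P P' → UCong Q Q' → HeadCong (par P Q) (par Q' P')
  | prio (x) {P P' Q Q'} : UCong P P' → UCong Q Q' → HeadCong (prio x P Q) (prio x P' Q')

/-- Simulation of heads: `Q` has, up to congruence, every head that `P` evaluates to. -/
def HeadSim (P Q : Proc) : Prop :=
  ∀ n h, HeadEval n P h → ∃ n' h', HeadEval n' Q h' ∧ HeadCong h h'

namespace HeadEval

theorem unique {n n' : ℕ} {P h h' : Proc} (H : HeadEval n P h) (H' : HeadEval n' P h') :
    n = n' ∧ h = h' := by
  induction H generalizing n' h' with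
  | recu _ ih => cases H' with | recu H' => exact ⟨congrArg _ (ih H').1, (ih H').2⟩
  | ite_true _ ih => cases H' with | ite_true H' => exact ⟨congrArg _ (ih H').1, (ih H').2⟩
  | ite_false _ ih => cases H' with | ite_false H' => exact ⟨congrArg _ (ih H').1, (ih H').2⟩
  | _ => cases H'; exact ⟨rfl, rfl⟩

theorem headCong_refl {n : ℕ} {P h : Proc} (H : HeadEval n P h) : HeadCong h h := by
  induction H with
  | out x y => exact .out x y
  | sum w α P => exact .sum w α fun i => .refl (P i)
  | nu P => exact .nu (.refl P)
  | par P Q => exact .par (.refl P) (.refl Q)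
  | prio x P Q => exact .prio x (.refl P) (.refl Q)
  | recu _ ih => exact ih
  | ite_true _ ih => exact ih
  | ite_false _ ih => exact ih

theorem psubst {n : ℕ} {P h : Proc} (H : HeadEval n P h) (θ : ℕ → Proc) :
    HeadEval n (P.psubst θ) (h.psubst θ) := by
  induction H with
  | recu _ ih => rw [unfold_psubst] at ih; exact .recu ih
  | ite_true _ ih => exact .ite_true ih
  | ite_false _ ih => exact .ite_false ih
  | _ => constructor

theorem of_psubst {n : ℕ} {P h : Proc} {θ : ℕ → Proc} (H : HeadEval n (P.psubst θ) h) :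
    (∃ h', HeadEval n P h' ∧ h = h'.psubst θ) ∨ ∃ k m, m ≤ n ∧ HeadEval m (θ k) h := by
  induction n generalizing P with
  | zero =>
    cases P with
    | pvar k => exact .inr ⟨k, 0, le_rfl, H⟩
    | _ => cases H <;> exact .inl ⟨_, by constructor, rfl⟩
  | succ n ih =>
    cases P with
    | pvar k => exact .inr ⟨k, n + 1, le_rfl, H⟩
    | recu P =>
      rw [psubst_recu] at H
      cases H with | recu H =>
      rw [← unfold_psubst] at H
      exact (ih H).imp (fun ⟨h', H', e⟩ => ⟨h', .recu H', e⟩)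
        fun ⟨k, m, hm, H'⟩ => ⟨k, m, hm.trans n.le_succ, H'⟩
    | ite b P Q =>
      rw [Proc.psubst] at H
      cases H with
      | ite_true H =>
        exact (ih H).imp (fun ⟨h', H', e⟩ => ⟨h', .ite_true H', e⟩)
          fun ⟨k, m, hm, H'⟩ => ⟨k, m, hm.trans n.le_succ, H'⟩
      | ite_false H =>
        exact (ih H).imp (fun ⟨h', H', e⟩ => ⟨h', .ite_false H', e⟩)
          fun ⟨k, m, hm, H'⟩ => ⟨k, m, hm.trans n.le_succ, H'⟩
    | _ => cases H

theorem offers {n : ℕ} {P h : Proc} (H : HeadEval n P h) {x : Name} (hx : h.Offers x) :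
    P.Offers x := by
  induction H with
  | recu _ ih => exact .recu (ih hx)
  | ite_true _ ih => exact .ite_true (ih hx)
  | ite_false _ ih => exact .ite_false (ih hx)
  | _ => exact hx

end HeadEval

namespace HeadCong

theorem symm {P Q : Proc} (h : HeadCong P Q) : HeadCong Q P := by
  cases h with
  | out x y => exact .out x y
  | sum w α h => exact .sum w α fun i => (h i).symm
  | nu h => exact .nu h.symm
  | par h₁ h₂ => exact .par h₁.symm h₂.symm
  | par_swap h₁ h₂ => exact .par_swap h₂.symm h₁.symm
  | prio x h₁ h₂ => exact .prio x h₁.symm h₂.symm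

theorem trans {P Q R : Proc} (h : HeadCong P Q) (h' : HeadCong Q R) : HeadCong P R := by
  cases h with
  | out x y => exact h'
  | sum w α h => cases h' with | sum _ _ h' => exact .sum w α fun i => (h i).trans (h' i)
  | nu h => cases h' with | nu h' => exact .nu (h.trans h')
  | par h₁ h₂ =>
    cases h' with
    | par h₃ h₄ => exact .par (h₁.trans h₃) (h₂.trans h₄)
    | par_swap h₃ h₄ => exact .par_swap (h₁.trans h₃) (h₂.trans h₄)
  | par_swap h₁ h₂ =>
    cases h' with
    | par h₃ h₄ => exact .par_swap (h₁.trans h₄) (h₂.trans h₃)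
    | par_swap h₃ h₄ => exact .par (h₁.trans h₄) (h₂.trans h₃)
  | prio x h₁ h₂ => cases h' with | prio _ h₃ h₄ => exact .prio x (h₁.trans h₃) (h₂.trans h₄)

theorem psubst {P Q : Proc} (h : HeadCong P Q) {θ θ' : ℕ → Proc}
    (hθ : ∀ k, UCong (θ k) (θ' k)) : HeadCong (P.psubst θ) (Q.psubst θ') := by
  cases h with
  | out x y => exact .out x y
  | sum w α h => exact .sum w α fun i => (h i).psubst_congr fun k => (hθ k).underPrefix _
  | nu h => exact .nu (h.psubst_congr fun k => (hθ k).subst _)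
  | par h₁ h₂ => exact .par (h₁.psubst_congr hθ) (h₂.psubst_congr hθ)
  | par_swap h₁ h₂ => exact .par_swap (h₁.psubst_congr hθ) (h₂.psubst_congr hθ)
  | prio x h₁ h₂ =>
    exact .prio x (h₁.psubst_congr fun k => (hθ k).subst _) (h₂.psubst_congr hθ)

theorem headSim {P Q : Proc} (h : HeadCong P Q) : HeadSim P Q := by
  intro n k H
  have hPQ := h
  cases h <;> cases H <;> exact ⟨0, _, by constructor, hPQ⟩

end HeadCong

namespace HeadSim

theorem refl (P : Proc) : HeadSim P P := fun n h H => ⟨n, h, H, H.headCong_refl⟩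

theorem trans {P Q R : Proc} (h : HeadSim P Q) (h' : HeadSim Q R) : HeadSim P R := by
  intro n k H
  obtain ⟨_, _, H₁, c₁⟩ := h n k H
  obtain ⟨_, _, H₂, c₂⟩ := h' _ _ H₁
  exact ⟨_, _, H₂, c₁.trans c₂⟩

theorem recu {P Q : Proc} (hPQ : UCong P Q) (h : HeadSim P Q) : HeadSim (recu P) (recu Q) := by
  rintro _ k (_ | _ | _ | _ | _ | H)
  rcases H.of_psubst with ⟨_, H₁, rfl⟩ | ⟨_ | j, m, hm, H₁⟩
  · obtain ⟨n', _, H₂, c⟩ := h _ _ H₁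
    refine ⟨n' + 1, _, .recu (H₂.psubst _), c.psubst fun j => ?_⟩
    cases j with
    | zero => exact .recu hPQ
    | succ j => exact .refl (pvar j)
  -- If `P` had its own variable at the head, then `recu P` would evaluate faster than itself.
  · exact absurd (H₁.unique (.recu H)).1 (by omega)
  · cases H₁

theorem ite {P P' Q Q' : Proc} (b : Name) (hP : HeadSim P P') (hQ : HeadSim Q Q') :
    HeadSim (ite b P Q) (ite b P' Q') := by
  rintro _ k (_ | _ | _ | _ | _ | _ | H | H)
  · obtain ⟨_, _, H', c⟩ := hP _ _ H
    exact ⟨_, _, .ite_true H', c⟩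
  · obtain ⟨_, _, H', c⟩ := hQ _ _ H
    exact ⟨_, _, .ite_false H', c⟩

end HeadSim

namespace UCong

theorem headSim {P Q : Proc} (h : UCong P Q) : HeadSim P Q ∧ HeadSim Q P := by
  have of_headCong {P Q : Proc} (h : HeadCong P Q) : HeadSim P Q ∧ HeadSim Q P :=
    ⟨h.headSim, h.symm.headSim⟩
  induction h with
  | refl P => exact ⟨.refl P, .refl P⟩
  | symm _ ih => exact ih.symm
  | trans _ _ ih₁ ih₂ => exact ⟨ih₁.1.trans ih₂.1, ih₂.2.trans ih₁.2⟩
  | par_comm P Q => exact of_headCong (.par_swap (.refl P) (.refl Q))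
  | recu_unfold P =>
    exact ⟨fun _ _ (.recu H) => ⟨_, _, H, H.headCong_refl⟩,
      fun _ _ H => ⟨_, _, .recu H, H.headCong_refl⟩⟩
  | ite_true P Q =>
    exact ⟨fun _ _ (.ite_true H) => ⟨_, _, H, H.headCong_refl⟩,
      fun _ _ H => ⟨_, _, .ite_true H, H.headCong_refl⟩⟩
  | ite_false P Q =>
    exact ⟨fun _ _ (.ite_false H) => ⟨_, _, H, H.headCong_refl⟩,
      fun _ _ H => ⟨_, _, .ite_false H, H.headCong_refl⟩⟩
  | sum w α h _ => exact of_headCong (.sum w α h)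
  | nu h _ => exact of_headCong (.nu h)
  | par h₁ h₂ _ _ => exact of_headCong (.par h₁ h₂)
  | recu h ih => exact ⟨.recu h ih.1, .recu h.symm ih.2⟩
  | ite b _ _ ih₁ ih₂ => exact ⟨.ite b ih₁.1 ih₂.1, .ite b ih₁.2 ih₂.2⟩
  | prio x h₁ h₂ _ _ => exact of_headCong (.prio x h₁ h₂)

theorem offers {P Q : Proc} (h : UCong P Q) {x : Name} (hx : P.Offers x) : Q.Offers x := by
  induction hx generalizing Q with
  | out x y =>
    obtain ⟨_, _, H, c⟩ := h.headSim.1 _ _ (.out x y)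
    cases c with | out => exact H.offers (.out x y)
  | nu _ ih =>
    obtain ⟨_, _, H, c⟩ := h.headSim.1 _ _ (.nu _)
    cases c with | nu h => exact H.offers (.nu (ih h))
  | par_left _ ih =>
    obtain ⟨_, _, H, c⟩ := h.headSim.1 _ _ (.par _ _)
    cases c with
    | par h _ => exact H.offers (.par_left (ih h))
    | par_swap h _ => exact H.offers (.par_right (ih h))
  | par_right _ ih =>
    obtain ⟨_, _, H, c⟩ := h.headSim.1 _ _ (.par _ _)
    cases c with
    | par _ h => exact H.offers (.par_right (ih h))
    | par_swap _ h => exact H.offers (.par_left (ih h))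
  | recu _ ih => exact ih ((recu_unfold _).symm.trans h)
  | ite_true _ ih => exact ih ((ite_true _ _).symm.trans h)
  | ite_false _ ih => exact ih ((ite_false _ _).symm.trans h)

theorem of_nu {P Q : Proc} (h : UCong (Proc.nu P) (Proc.nu Q)) : UCong P Q := by
  obtain ⟨_, _, ⟨⟩, c⟩ := h.headSim.1 _ _ (.nu P)
  cases c with | nu h => exact h

end UCong

end Proc

/-! ## Components -/

namespace Election

open Proc

/-- The components that matter for the election: a pending output of the boolean `b` on channel
`j`, process `i` before a draw, process `i` waiting for the channel `j` that it has drawn, and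
process `i` holding channel `j` and asking for the other one. -/
inductive Component : Type
  | token (j : Fin 2) (b : Bool)
  | idle (i : Fin 2)
  | waiting (i j : Fin 2)
  | holding (i j : Fin 2)
  deriving DecidableEq

/-- The recursive part of process `i`. -/
noncomputable def loop (i : Fin 2) : Proc :=
  recu (sum (PMF.uniformOfFintype (Fin 2))
    (fun k => Prefix.tau (some (i, i + k))) (fun k => branch i (i + k)))

/-- The priority choice of process `i` when it holds channel `j`. -/
noncomputable def holder (i j : Fin 2) : Proc :=
  prio (x (j + 1)) (par (out (o i) (Name.num i)) (out (x j).shift (Name.bool false)))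
    (par (out (x j) (Name.bool true)) (loop i))

namespace Component

/-- The process that a component stands for. -/
noncomputable def proc : Component → Proc
  | token j b => out (x j) (Name.bool b)
  | idle i => loop i
  | waiting i j => (branch i j).psubst (instProc (loop i))
  | holding i j => holder i j

/-- What becomes of a component when it receives the boolean `b` on channel `k`; `none` if it does
not listen on that channel. -/
def recv : Component → Fin 2 → Bool → Option (Multiset Component)
  | waiting i j, k, b => if k = j then some (if b then {holding i j} else 0) else none
  | holding _ j, k, _ => if k = j + 1 then some {token j false} else none
  | _, _, _ => none

end Component

open Component

theorem x_injective : Function.Injective x := by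
  intro a b h
  fin_cases a <;> fin_cases b <;> first | rfl | cases h

theorem x_ne_chan (j : Fin 2) (k : ℕ) : x j ≠ Name.chan k := by
  fin_cases j <;> exact Name.noConfusion

theorem exists_waiting_proc_eq (i j : Fin 2) :
    ∃ P, (waiting i j).proc = pre (Prefix.inp (x j)) P ∧
      ∀ b, P.subst (Name.inst (Name.bool b)) = Proc.ite (Name.bool b) (holder i j)
        (out (o i) (Name.num ((i + 1 : Fin 2) : ℕ))) := by
  refine ⟨_, rfl, fun b => ?_⟩
  simp only [psubst, Proc.subst, underPrefix, Prefix.toAct, under, instProc, holder,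
    Name.shift_subst_inst, Proc.shift_subst_inst, Name.shift_subst_liftSubst]
  rfl

/-- Up to congruence, the process is a parallel composition of the given components, of inactive
processes, and of announcements of a leader. -/
inductive HasComponents : Proc → Multiset Component → Prop
  | nil : HasComponents nil 0
  | msg (k l : ℕ) : HasComponents (out (Name.chan k) (Name.num l)) 0
  | component (a : Component) : HasComponents a.proc {a}
  | par {P Q m n} : HasComponents P m → HasComponents Q n → HasComponents (par P Q) (m + n)
  | congr {P Q m} : UCong P Q → HasComponents Q m → HasComponents P m

/-- The heads that a process with the given components can evaluate to. -/
inductive HeadComponents : Proc → Multiset Component → Prop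
  | msg (k l : ℕ) : HeadComponents (out (Name.chan k) (Name.num l)) 0
  | token (j : Fin 2) (b : Bool) : HeadComponents (out (x j) (Name.bool b)) {token j b}
  | idle {i P} : (∀ k, HasComponents (P k) {waiting i (i + k)}) →
      HeadComponents (sum (PMF.uniformOfFintype (Fin 2)) (fun k => Prefix.tau (some (i, i + k))) P)
        {idle i}
  | waiting {i j P} :
      (∀ b, HasComponents ((P 0).subst (Name.inst (Name.bool b)))
        (if b then {holding i j} else 0)) →
      HeadComponents (sum (PMF.pure (0 : Fin 1)) (fun _ => Prefix.inp (x j)) P) {waiting i j}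
  | holding {i j P Q} :
      (∀ b, HasComponents (P.subst (Name.inst (Name.bool b))) {Component.token j false}) →
      HasComponents Q {Component.token j true, Component.idle i} →
      HeadComponents (prio (x (j + 1)) P Q) {holding i j}
  | par {P Q m n} : HasComponents P m → HasComponents Q n → HeadComponents (par P Q) (m + n)

theorem HeadComponents.headCong {P Q : Proc} {m : Multiset Component} (h : HeadComponents P m)
    (hPQ : HeadCong P Q) : HeadComponents Q m := by
  cases h with
  | msg k l => cases hPQ; exact .msg k l
  | token j b => cases hPQ; exact .token j b
  | idle h => cases hPQ with | sum _ _ c => exact .idle fun k => .congr (c k).symm (h k)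
  | waiting h =>
    cases hPQ with | sum _ _ c => exact .waiting fun b => .congr ((c 0).symm.subst _) (h b)
  | holding h₁ h₂ =>
    cases hPQ with | prio _ c₁ c₂ =>
    exact .holding (fun b => .congr (c₁.symm.subst _) (h₁ b)) (.congr c₂.symm h₂)
  | par h₁ h₂ =>
    cases hPQ with
    | par c₁ c₂ => exact .par (.congr c₁.symm h₁) (.congr c₂.symm h₂)
    | par_swap c₁ c₂ =>
      rw [add_comm]
      exact .par (.congr c₂.symm h₂) (.congr c₁.symm h₁)

theorem Component.exists_headEval (a : Component) :
    ∃ n h, HeadEval n a.proc h ∧ HeadComponents h {a} := by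
  cases a with
  | token j b => exact ⟨0, _, .out _ _, .token j b⟩
  | idle i => exact ⟨1, _, .recu (.sum _ _ _), .idle fun k => .component (waiting i (i + k))⟩
  | waiting i j =>
    obtain ⟨P, hP, hsubst⟩ := exists_waiting_proc_eq i j
    rw [hP]
    refine ⟨0, _, .sum _ _ _, .waiting fun b => ?_⟩
    rw [hsubst]
    cases b
    · exact .congr (.ite_false _ _) (.msg _ _)
    · exact .congr (.ite_true _ _) (.component (holding i j))
  | holding i j =>
    refine ⟨0, _, .prio _ _ _, .holding (fun b => ?_)
      (.par (.component (token j true)) (.component (idle i)))⟩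
    rw [← zero_add {_}, Proc.subst, Proc.subst, Proc.subst, Name.shift_subst_inst]
    exact .par (.msg i i) (.component (token j false))

namespace HasComponents

theorem headComponents {P h : Proc} {m : Multiset Component} {n : ℕ} (hm : HasComponents P m)
    (hP : HeadEval n P h) : HeadComponents h m := by
  induction hm generalizing n h with
  | nil => cases hP
  | msg k l => cases hP; exact .msg k l
  | component a =>
    obtain ⟨_, k, H, hk⟩ := a.exists_headEval
    rwa [(hP.unique H).2]
  | par h₁ h₂ => cases hP; exact .par h₁ h₂
  | congr hPQ _ ih =>
    obtain ⟨_, _, H, c⟩ := hPQ.headSim.1 _ _ hP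
    exact (ih H).headCong c.symm

theorem offers {P : Proc} {m : Multiset Component} (hm : HasComponents P m) {j : Fin 2} {b : Bool}
    (hjb : token j b ∈ m) : P.Offers (x j) := by
  induction hm with
  | nil => simp at hjb
  | msg k l => simp at hjb
  | component a => rw [← Multiset.mem_singleton.1 hjb]; exact .out _ _
  | par _ _ ih₁ ih₂ =>
    exact (Multiset.mem_add.1 hjb).elim (fun h => .par_left (ih₁ h)) fun h => .par_right (ih₂ h)
  | congr hPQ _ ih => exact hPQ.symm.offers (ih hjb)

end HasComponents

end Election

/-! ## Transitions of the components -/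

theorem pmf_map_congr {α β : Type*} {p : PMF α} {f g : α → β} (h : ∀ a ∈ p.support, f a = g a) :
    p.map f = p.map g := by
  ext b
  simp only [PMF.map_apply]
  refine tsum_congr fun a => ?_
  by_cases ha : a ∈ p.support
  · rw [h a ha]
  · simp only [(p.apply_eq_zero_iff a).2 ha, ite_self]

theorem Proc.comTarget_of_ne {P P' : Proc} {y v : Name} {a : Act × Proc} (h : a.1 ≠ Act.inp y) :
    comTarget P P' y v a = (a.1, par (P.under a.1) a.2) := by
  rcases a with ⟨_ | _ | _ | _, Q⟩
  · exact if_neg fun hz => h (congrArg _ hz)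
  all_goals rfl

namespace Election

open Proc Component

/-- A silent step from components `m` to components `m'`, not a draw, when the rest of the system
offers outputs on `E`: a process releases the channel that it holds, or a component takes a
message. -/
inductive SilentStep (E : Set Name) : Multiset Component → Multiset Component → Prop
  | release {i j m} : x (j + 1) ∉ E → (∀ b, token (j + 1) b ∉ m) →
      SilentStep E (holding i j ::ₘ m) (token j true ::ₘ idle i ::ₘ m)
  | comm {a j b r m} : a.recv j b = some r → SilentStep E (token j b ::ₘ a ::ₘ m) (r + m)

/-- The groups of a process with components `m` that do not use a channel. The relation `R` says
which components a process has: it is `HasComponents` first, then the same under restrictions. -/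
inductive InternalGroup (R : Proc → Multiset Component → Prop) (E : Set Name) :
    Multiset Component → PMF (Act × Proc) → Prop
  | msg {m P} (k l : ℕ) : R P m →
      InternalGroup R E m (PMF.pure (Act.out (Name.chan k) (Name.num l), P))
  | silent {m m' P} : SilentStep E m m' → R P m' →
      InternalGroup R E m (PMF.pure (Act.tau none, P))
  | draw {i m} {P : Fin 2 → Proc} : (∀ k, R (P k) (waiting i (i + k) ::ₘ m)) →
      InternalGroup R E (idle i ::ₘ m)
        ((PMF.uniformOfFintype (Fin 2)).map fun k => (Act.tau (some (i, i + k)), P k))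

/-- The groups of a process with components `m`. -/
inductive ComponentGroup (E : Set Name) : Multiset Component → PMF (Act × Proc) → Prop
  | internal {m g} : InternalGroup HasComponents E m g → ComponentGroup E m g
  | out {j b m P} : HasComponents P m →
      ComponentGroup E (token j b ::ₘ m) (PMF.pure (Act.out (x j) (Name.bool b), P))
  | inp {j a m P} : (∀ b, ∃ r ∈ a.recv j b,
        HasComponents (P.subst (Name.inst (Name.bool b))) (r + m)) →
      ComponentGroup E (a ::ₘ m) (PMF.pure (Act.inp (x j), P))

theorem SilentStep.add {E E' : Set Name} {m m' n : Multiset Component} (h : SilentStep E m m')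
    (hE : ∀ j, x j ∈ E' ∨ (∃ b, token j b ∈ n) → x j ∈ E) : SilentStep E' (m + n) (m' + n) := by
  cases h with
  | release hx hm =>
    simp only [Multiset.cons_add]
    refine .release (fun h => hx (hE _ (.inl h))) fun b hb => ?_
    exact (Multiset.mem_add.1 hb).elim (hm b) fun hb => hx (hE _ (.inr ⟨b, hb⟩))
  | comm h =>
    rw [Multiset.cons_add, Multiset.cons_add, add_assoc]
    exact .comm h

/-- `Q` has `n` more components than `P`, both being reached by the action `μ`: whatever name is
received, if `μ` is an input. -/
def Extends (n : Multiset Component) (P Q : Proc) : Act → Prop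
  | Act.inp _ => ∀ y m, HasComponents (P.subst (Name.inst y)) m →
      HasComponents (Q.subst (Name.inst y)) (m + n)
  | _ => ∀ m, HasComponents P m → HasComponents Q (m + n)

namespace Extends

theorem of_uCong {P Q : Proc} (h : UCong Q P) (μ : Act) : Extends 0 P Q μ := by
  cases μ with
  | inp z => exact fun y m hm => .congr (h.subst _) (by rwa [add_zero])
  | _ => exact fun m hm => .congr h (by rwa [add_zero])

theorem par_under {P Q : Proc} {n : Multiset Component} {μ : Act} (hQ : HasComponents Q n)
    (hμ : ∀ z, μ ≠ Act.bout z) : Extends n P (par P (Q.under μ)) μ := by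
  cases μ with
  | inp z =>
    intro y m hm
    rw [under, Proc.subst, Proc.shift_subst_inst]
    exact .par hm hQ
  | bout z => exact (hμ z rfl).elim
  | _ => exact fun m hm => .par hm hQ

theorem congr {P Q Q' : Proc} {n : Multiset Component} {μ : Act} (h : Extends n P Q μ)
    (hQ : UCong Q' Q) : Extends n P Q' μ := by
  cases μ with
  | inp z => exact fun y m hm => .congr (hQ.subst _) (h y m hm)
  | _ => exact fun m hm => .congr hQ (h m hm)

end Extends

namespace ComponentGroup

variable {E E' : Set Name} {m n : Multiset Component} {g : PMF (Act × Proc)}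

theorem map {F : Act × Proc → Proc} (h : ComponentGroup E m g)
    (hE : ∀ j, x j ∈ E' ∨ (∃ b, token j b ∈ n) → x j ∈ E)
    (hF : ∀ a ∈ g.support, Extends n a.2 (F a) a.1) :
    ComponentGroup E' (m + n) (g.map fun a => (a.1, F a)) := by
  have hF_pure {a} (ha : g = PMF.pure a) : Extends n a.2 (F a) a.1 := hF a (by simp [ha])
  cases h with
  | internal h =>
    cases h with
    | msg k l h =>
      rw [PMF.pure_map]
      exact .internal (.msg k l (hF_pure rfl _ h))
    | silent hs h =>
      rw [PMF.pure_map]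
      exact .internal (.silent (hs.add hE) (hF_pure rfl _ h))
    | draw h =>
      rw [PMF.map_comp, Multiset.cons_add]
      refine .internal (.draw fun k => ?_)
      rw [← Multiset.cons_add]
      exact hF _ ((PMF.mem_support_map_iff _ _ _).2 ⟨k, by simp, rfl⟩) _ (h k)
  | out h =>
    rw [PMF.pure_map, Multiset.cons_add]
    exact .out (hF_pure rfl _ h)
  | inp h =>
    rw [PMF.pure_map, Multiset.cons_add]
    refine .inp fun b => ?_
    obtain ⟨r, hr, hP⟩ := h b
    exact ⟨r, hr, by rw [← add_assoc]; exact hF_pure rfl _ _ hP⟩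

theorem ne_bout (h : ComponentGroup E m g) {a : Act × Proc} (ha : a ∈ g.support) (z : Name) :
    a.1 ≠ Act.bout z := by
  rcases a with ⟨μ, P⟩
  rintro rfl
  cases h with
  | internal h => cases h <;> simp at ha
  | out => simp at ha
  | inp => simp at ha

theorem of_mem_inp {y : Name} {P : Proc} (h : ComponentGroup E m g)
    (hP : (Act.inp y, P) ∈ g.support) :
    g = PMF.pure (Act.inp y, P) ∧ ∃ j a m', y = x j ∧ m = a ::ₘ m' ∧ ∀ b, ∃ r ∈ a.recv j b,
      HasComponents (P.subst (Name.inst (Name.bool b))) (r + m') := by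
  cases h with
  | internal h => cases h <;> simp at hP
  | out => simp at hP
  | inp h =>
    cases (PMF.mem_support_pure_iff _ _).1 hP
    exact ⟨rfl, _, _, _, rfl, rfl, h⟩

theorem of_pure_out {y v : Name} {P : Proc} (h : ComponentGroup E m (PMF.pure (Act.out y v, P))) :
    (∃ j b m', y = x j ∧ v = Name.bool b ∧ m = token j b ::ₘ m' ∧ HasComponents P m') ∨
      ∃ k, y = Name.chan k := by
  generalize hg : PMF.pure (Act.out y v, P) = g at h
  have hP : (Act.out y v, P) ∈ g.support := by simp [← hg]
  cases h with
  | internal h =>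
    cases h with
    | msg k l => cases (PMF.mem_support_pure_iff _ _).1 hP; exact .inr ⟨k, rfl⟩
    | silent => simp at hP
    | draw => simp at hP
  | out h =>
    cases (PMF.mem_support_pure_iff _ _).1 hP
    exact .inl ⟨_, _, _, rfl, rfl, rfl, h⟩
  | inp => simp at hP

end ComponentGroup

section Step

variable {E : Set Name} {m : Multiset Component}

theorem HeadComponents.componentGroup_sum {k : ℕ} {w : PMF (Fin k)} {α : Fin k → Prefix}
    {P : Fin k → Proc} (h : HeadComponents (Proc.sum w α P) m) :
    ComponentGroup E m (w.map fun i => ((α i).toAct, P i)) := by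
  cases h with
  | idle h => exact .internal (.draw h)
  | @waiting i j P h =>
    rw [PMF.pure_map]
    refine .inp (m := 0) fun b => ⟨_, if_pos rfl, ?_⟩
    simpa only [add_zero] using h b

theorem HeadComponents.componentGroup_out {y v : Name} (h : HeadComponents (Proc.out y v) m) :
    ComponentGroup E m (PMF.pure (Act.out y v, nil)) := by
  cases h with
  | msg k l => exact .internal (.msg k l .nil)
  | token j b => exact .out .nil

theorem HeadComponents.componentGroup_prio_inp {y : Name} {P Q : Proc}
    (h : HeadComponents (prio y P Q) m) :
    ComponentGroup E m (PMF.pure (Act.inp y, P)) := by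
  cases h with
  | holding h _ =>
    refine .inp (m := 0) fun b => ⟨_, if_pos rfl, ?_⟩
    simpa only [add_zero] using h b

theorem HeadComponents.componentGroup_prio_tau {y : Name} {P Q : Proc}
    (h : HeadComponents (prio y P Q) m) (hy : y ∉ E) :
    ComponentGroup E m (PMF.pure (Act.tau none, Q)) := by
  cases h with
  | holding _ h => exact .internal (.silent (.release (m := 0) hy (by simp)) h)

variable {m₁ m₂ : Multiset Component} {P P' Q : Proc} {g : PMF (Act × Proc)}

theorem HasComponents.mem_union_offers (hQ : HasComponents Q m) (j : Fin 2) :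
    x j ∈ E ∨ (∃ b, token j b ∈ m) → x j ∈ E ∪ {x | Q.Offers x} :=
  Or.imp_right fun ⟨_, hb⟩ => hQ.offers hb

theorem ComponentGroup.par (h : ComponentGroup (E ∪ {x | Q.Offers x}) m₁ g)
    (hQ : HasComponents Q m₂) : ComponentGroup E (m₁ + m₂) (g.map (parTarget Q)) :=
  h.map hQ.mem_union_offers fun _ ha => .par_under hQ (h.ne_bout ha)

theorem ComponentGroup.com {y v : Name}
    (hP : ComponentGroup (E ∪ {x | Q.Offers x}) m₁ (PMF.pure (Act.out y v, P')))
    (hg : ComponentGroup (E ∪ {x | P.Offers x}) m₂ g) (hPm : HasComponents P m₁) :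
    ComponentGroup E (m₁ + m₂) (g.map (comTarget P P' y v)) := by
  by_cases hy : ∃ R, (Act.inp y, R) ∈ g.support
  · obtain ⟨R, hR⟩ := hy
    obtain ⟨rfl, j, a, m₂, rfl, rfl, hr⟩ := hg.of_mem_inp hR
    rcases hP.of_pure_out with ⟨j', b, m₁, hj, rfl, rfl, hP'⟩ | ⟨k, hk⟩
    · obtain rfl := x_injective hj
      obtain ⟨r, hr, hRm⟩ := hr b
      have hcomm : SilentStep E (token j b ::ₘ m₁ + a ::ₘ m₂) (m₁ + (r + m₂)) := by
        rw [Multiset.cons_add, Multiset.add_cons, add_left_comm]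
        exact .comm hr
      rw [PMF.pure_map, Proc.comTarget, if_pos rfl]
      exact .internal (.silent hcomm (.par hP' hRm))
    · exact absurd hk (x_ne_chan j k)
  · have hcom : ∀ a ∈ g.support, Proc.comTarget P P' y v a = (a.1, Proc.par (P.under a.1) a.2) :=
      fun a ha => comTarget_of_ne fun h => hy ⟨a.2, h ▸ ha⟩
    rw [pmf_map_congr hcom, add_comm]
    exact hg.map hPm.mem_union_offers fun a ha =>
      (Extends.par_under hPm (hg.ne_bout ha)).congr (.par_comm _ _)

end Step

theorem HasComponents.componentGroup {E : Set Name} {P : Proc} {m : Multiset Component}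
    {g : PMF (Act × Proc)} (hm : HasComponents P m) (h : Step E P g) : ComponentGroup E m g := by
  induction h generalizing m with
  | sum => exact (hm.headComponents (.sum _ _ _)).componentGroup_sum
  | out => exact (hm.headComponents (.out _ _)).componentGroup_out
  | prio_inp => exact (hm.headComponents (.prio _ _ _)).componentGroup_prio_inp
  | prio_tau _ _ hy => exact (hm.headComponents (.prio _ _ _)).componentGroup_prio_tau hy
  | opn => cases hm.headComponents (.nu _)
  | res => cases hm.headComponents (.nu _)
  | par _ ih =>
    cases hm.headComponents (.par _ _) with | par hP hQ => exact (ih hP).par hQ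
  | com _ _ ihP ihQ =>
    cases hm.headComponents (.par _ _) with | par hP hQ => exact (ihP hP).com (ihQ hQ) hP
  | close _ _ ihP _ =>
    cases hm.headComponents (.par _ _) with | par hP _ =>
    exact ((ihP hP).ne_bout ((PMF.mem_support_pure_iff _ _).2 rfl) _ rfl).elim
  | cong f hPP' _ hf ih =>
    rw [← add_zero m]
    exact (ih (.congr hPP'.uCong.symm hm)).map (by simp) fun a ha =>
      .of_uCong (hf a ha).uCong.symm _

end Election

/-! ## Restriction -/

theorem pmf_filter_eq_self {α : Type*} (p : PMF α) {s : Set α} (h : ∃ a ∈ s, a ∈ p.support)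
    (hs : p.support ⊆ s) : p.filter s h = p := by
  ext a
  rw [PMF.filter_apply, Set.indicator_eq_self.2 hs, p.tsum_coe, inv_one, mul_one]

theorem Name.shift_lower {y : Name} (h : y ≠ var 0) : y.lower.shift = y := by
  cases y with
  | var k => cases k with
    | zero => exact (h rfl).elim
    | succ k => rfl
  | _ => rfl

namespace Proc

/-- The group `g` of a restricted process stems, up to congruence of the processes that are
reached, from the group `g'` of the process under the restriction. -/
inductive NuGroup : PMF (Act × Proc) → PMF (Act × Proc) → Prop
  | opn {y P Q} : UCong P Q →
      NuGroup (PMF.pure (Act.out y (Name.var 0), P)) (PMF.pure (Act.bout y.lower, Q))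
  | res {g' : PMF (Act × Proc)} {f : Act × Proc → Proc}
      (h : ∃ a ∈ {a : Act × Proc | ¬ a.1.HasFree (Name.var 0)}, a ∈ g'.support) :
      (∀ a ∈ (g'.filter _ h).support, UCong (f a) (resTarget a).2) →
      NuGroup g' ((g'.filter _ h).map fun a => ((resTarget a).1, f a))

theorem NuGroup.congr {g' g : PMF (Act × Proc)} {f : Act × Proc → Proc} (h : NuGroup g' g)
    (hf : ∀ a ∈ g.support, UCong a.2 (f a)) : NuGroup g' (g.map fun a => (a.1, f a)) := by
  cases h with
  | opn hPQ =>
    rw [PMF.pure_map]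
    exact .opn (hPQ.trans (hf _ ((PMF.mem_support_pure_iff _ _).2 rfl)))
  | @res _ f' h hf' =>
    rw [PMF.map_comp]
    exact .res (f := fun a => f ((resTarget a).1, f' a)) h fun a ha =>
      (hf _ ((PMF.mem_support_map_iff _ _ _).2 ⟨a, ha, rfl⟩)).symm.trans (hf' a ha)

theorem Step.exists_nuGroup {E : Set Name} {P Q : Proc} {g : PMF (Act × Proc)} (h : Step E P g)
    (hP : UCong P (nu Q)) :
    ∃ Q' g', UCong Q' Q ∧ Step (Name.shift '' E) Q' g' ∧ NuGroup g' g := by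
  induction h with
  | opn _ h _ => exact ⟨_, _, hP.of_nu, h, .opn (.refl _)⟩
  | res h hs _ => exact ⟨_, _, hP.of_nu, hs, .res h fun _ _ => .refl _⟩
  | cong f hPP' _ hf ih =>
    obtain ⟨Q', g', hQ', hs, hg⟩ := ih (hPP'.uCong.symm.trans hP)
    exact ⟨Q', g', hQ', hs, hg.congr fun a ha => (hf a ha).uCong⟩
  | _ =>
    obtain ⟨_, _, ⟨⟩, c⟩ := hP.headSim.1 _ _ (by constructor)
    cases c

end Proc

namespace Election

open Proc Component

/-- The action is an input on channel `y` or an output of a boolean on it. -/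
inductive UsesChannel (y : Name) : Act → Prop
  | inp : UsesChannel y (Act.inp y)
  | out (b : Bool) : UsesChannel y (Act.out y (Name.bool b))

/-- The groups of a process with components `m`, in the sense of `R`, that interacts with the rest
of the system through the channels in `C` only. -/
inductive ChannelGroup (R : Proc → Multiset Component → Prop) (C : Set Name)
    (m : Multiset Component) : PMF (Act × Proc) → Prop
  | internal {g} : InternalGroup R ∅ m g → ChannelGroup R C m g
  | channel {y μ P} : y ∈ C → UsesChannel y μ → ChannelGroup R C m (PMF.pure (μ, P))

/-- The process is congruent to the restriction of a process with the components `m`, in the sense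
of `R`. -/
def UnderNu (R : Proc → Multiset Component → Prop) (P : Proc) (m : Multiset Component) : Prop :=
  ∃ Q, UCong P (nu Q) ∧ R Q m

variable {R : Proc → Multiset Component → Prop} {C : Set Name} {m : Multiset Component}
  {P : Proc} {g g' : PMF (Act × Proc)}

theorem UnderNu.congr {Q : Proc} (hPQ : UCong P Q) (hQ : UnderNu R Q m) : UnderNu R P m := by
  obtain ⟨Q', hQQ', hR⟩ := hQ
  exact ⟨Q', hPQ.trans hQQ', hR⟩

theorem InternalGroup.not_hasFree_var {E : Set Name} {k : ℕ} (hg : InternalGroup R E m g)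
    {a : Act × Proc} (ha : a ∈ g.support) : ¬ a.1.HasFree (Name.var k) := by
  cases hg with
  | msg => cases (PMF.mem_support_pure_iff _ _).1 ha; simp [Act.HasFree]
  | silent => cases (PMF.mem_support_pure_iff _ _).1 ha; exact id
  | draw => obtain ⟨k, _, rfl⟩ := (PMF.mem_support_map_iff _ _ _).1 ha; exact id

theorem InternalGroup.underNu {E : Set Name} {f : Act × Proc → Proc} (hg : InternalGroup R E m g)
    (hf : ∀ a ∈ g.support, UCong (f a) (resTarget a).2) :
    InternalGroup (UnderNu R) E m (g.map fun a => ((resTarget a).1, f a)) := by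
  cases hg with
  | msg k l hP =>
    rw [PMF.pure_map]
    exact .msg k l ⟨_, hf _ ((PMF.mem_support_pure_iff _ _).2 rfl), hP⟩
  | silent hm hP =>
    rw [PMF.pure_map]
    exact .silent hm ⟨_, hf _ ((PMF.mem_support_pure_iff _ _).2 rfl), hP⟩
  | @draw i m P hP =>
    rw [PMF.map_comp]
    exact .draw (P := fun k => f (Act.tau (some (i, i + k)), P k)) fun k =>
      ⟨P k, hf _ ((PMF.mem_support_map_iff _ _ _).2 ⟨k, by simp, rfl⟩), hP k⟩

theorem ChannelGroup.out_var_notMem_support {y : Name} {k : ℕ} (hg : ChannelGroup R C m g) :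
    (Act.out y (Name.var k), P) ∉ g.support := by
  intro h
  cases hg with
  | internal hg => exact hg.not_hasFree_var h (.inr rfl)
  | channel _ hμ =>
    cases (PMF.mem_support_pure_iff _ _).1 h
    cases hμ

theorem ChannelGroup.underNu (hg' : ChannelGroup R C m g') (h : NuGroup g' g) :
    ChannelGroup (UnderNu R) (Name.shift ⁻¹' C) m g := by
  cases h with
  | opn =>
    exact (hg'.out_var_notMem_support ((PMF.mem_support_pure_iff _ _).2 rfl)).elim
  | res h hf =>
    obtain ⟨a, ha, hag⟩ := h
    cases hg' with
    | internal hg =>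
      have hsupp : g'.support ⊆ {a : Act × Proc | ¬ a.1.HasFree (Name.var 0)} :=
        fun _ => hg.not_hasFree_var
      rw [pmf_filter_eq_self g' _ hsupp] at hf ⊢
      exact .internal (hg.underNu hf)
    | @channel y μ P hy hμ =>
      cases (PMF.mem_support_pure_iff _ _).1 hag
      have hy0 : y ≠ Name.var 0 := by
        rintro rfl
        cases hμ
        · exact ha rfl
        · exact ha (.inl rfl)
      rw [pmf_filter_eq_self _ _ (by simpa using ha), PMF.pure_map]
      refine .channel (y := y.lower) (by rwa [Set.mem_preimage, Name.shift_lower hy0]) ?_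
      cases hμ
      · exact .inp
      · exact .out _

theorem UnderNu.channelGroup (hcongr : ∀ {P Q}, UCong P Q → R Q m → R P m)
    (hstep : ∀ {P g}, R P m → Step ∅ P g → ChannelGroup R C m g) (hP : UnderNu R P m)
    (hs : Step ∅ P g) : ChannelGroup (UnderNu R) (Name.shift ⁻¹' C) m g := by
  obtain ⟨Q, hPQ, hQ⟩ := hP
  obtain ⟨Q', g', hQ', hs', hg⟩ := hs.exists_nuGroup hPQ
  rw [Set.image_empty] at hs'
  exact (hstep (hcongr hQ' hQ) hs').underNu hg

theorem HasComponents.channelGroup (hP : HasComponents P m) (hs : Step ∅ P g) :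
    ChannelGroup HasComponents (Set.range x) m g := by
  cases hP.componentGroup hs with
  | internal h => exact .internal h
  | out _ => exact .channel (Set.mem_range_self _) (.out _)
  | inp _ => exact .channel (Set.mem_range_self _) .inp

/-- The process is, up to congruence, the network with the given components. -/
def Net : Proc → Multiset Component → Prop := UnderNu (UnderNu HasComponents)

theorem Net.internalGroup (hP : Net P m) (hs : Step ∅ P g) : InternalGroup Net ∅ m g := by
  have hg : ChannelGroup Net _ m g :=
    hP.channelGroup .congr (fun hP => hP.channelGroup .congr HasComponents.channelGroup) hs
  cases hg with
  | internal h => exact h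
  | @channel y _ _ hy _ =>
    obtain ⟨j, hj⟩ := hy
    cases y <;> fin_cases j <;> cases hj

theorem net_network : Net network {token 0 true, idle 0, token 1 true, idle 1} := by
  have hnode (i : Fin 2) : HasComponents (node i) {token i true, idle i} :=
    .par (.component (token i true)) (.component (idle i))
  exact ⟨_, .refl _, _, .refl _, (hnode 0).par (hnode 1)⟩

end Election

/-! ## Ranks -/

namespace Election

open Proc Component

/-- The components of the reachable processes from which no draw can follow: both processes have
drawn the same channel, or the process that has not won finds the message `f`, or nothing is left
to take. -/
def settled : List (Multiset Component) :=
  0 :: ([0, 1] : List (Fin 2)).flatMap fun j => {token j false} ::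
    ([0, 1] : List (Fin 2)).flatMap fun i => [
      {token 0 true, token 1 true, waiting i j, waiting (i + 1) j},
      {token (j + 1) true, holding i j, waiting (i + 1) j},
      {token j false, waiting i 0},
      {token j false, waiting i 1}]

/-- The components of the other reachable processes after the first draw. From them, one of the two
results of the next draw leads to settled components. -/
def contending : List (Multiset Component) :=
  ([0, 1] : List (Fin 2)).flatMap fun j => ([0, 1] : List (Fin 2)).flatMap fun i => [
    {token 0 true, token 1 true, idle i, waiting (i + 1) j},
    {token (j + 1) true, idle i, holding (i + 1) j},
    {token 0 true, token 1 true, waiting i j, waiting (i + 1) (j + 1)},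
    {token (j + 1) true, holding i j, waiting (i + 1) (j + 1)},
    {holding i j, holding (i + 1) (j + 1)},
    {token j false, idle i}]

/-- The components of the reachable processes, with their rank: `0` if they are settled, `1` if
they are contending, `2` before the first draw. -/
def ranked : List (ℕ × Multiset Component) :=
  settled.map (0, ·) ++ contending.map (1, ·) ++
    [(2, {token 0 true, idle 0, token 1 true, idle 1})]

/-- The components `m` have a rank that is at most `r`. -/
def RankLE (r : ℕ) (m : Multiset Component) : Prop :=
  ∃ s ∈ ranked, s.1 ≤ r ∧ s.2 = m

instance (r : ℕ) (m : Multiset Component) : Decidable (RankLE r m) :=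
  inferInstanceAs (Decidable (∃ s ∈ ranked, s.1 ≤ r ∧ s.2 = m))

theorem RankLE.mono {r r' : ℕ} {m : Multiset Component} (h : RankLE r m) (hr : r ≤ r') :
    RankLE r' m := by
  obtain ⟨s, hs, hsr, rfl⟩ := h
  exact ⟨s, hs, hsr.trans hr, rfl⟩

set_option maxRecDepth 100000 in
theorem rankLE_comm_of_mem_ranked : ∀ s ∈ ranked, ∀ j b, token j b ∈ s.2 →
    ∀ a ∈ s.2.erase (token j b), ∀ r ∈ a.recv j b,
      RankLE s.1 (r + (s.2.erase (token j b)).erase a) := by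
  decide +kernel

set_option maxRecDepth 100000 in
theorem rankLE_release_of_mem_ranked : ∀ s ∈ ranked, ∀ i j, holding i j ∈ s.2 →
    (∀ b, token (j + 1) b ∉ s.2.erase (holding i j)) →
      RankLE s.1 (token j true ::ₘ idle i ::ₘ s.2.erase (holding i j)) := by
  decide +kernel

set_option maxRecDepth 100000 in
theorem rankLE_draw_of_mem_ranked : ∀ s ∈ ranked, ∀ i, idle i ∈ s.2 → s.1 ≠ 0 ∧
    ∃ k, RankLE (s.1 - 1) (waiting i (i + k) ::ₘ s.2.erase (idle i)) ∧
      RankLE 1 (waiting i (i + (k + 1)) ::ₘ s.2.erase (idle i)) := by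
  decide +kernel

theorem SilentStep.rankLE {m m' : Multiset Component} {r : ℕ} (h : SilentStep ∅ m m')
    (hm : RankLE r m) : RankLE r m' := by
  obtain ⟨⟨s, n⟩, hs, hr, hn⟩ := hm
  obtain rfl : n = m := hn
  refine RankLE.mono ?_ hr
  cases h with
  | @release i j _ _ h =>
    simpa using rankLE_release_of_mem_ranked _ hs i j (by simp) (by simpa using h)
  | comm h => simpa using rankLE_comm_of_mem_ranked _ hs _ _ (by simp) _ (by simp) _ h

theorem RankLE.draw {i : Fin 2} {m : Multiset Component} {r : ℕ} (h : RankLE r (idle i ::ₘ m)) :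
    ∃ r', r = r' + 1 ∧ ∃ k, RankLE r' (waiting i (i + k) ::ₘ m) ∧
      RankLE 1 (waiting i (i + (k + 1)) ::ₘ m) := by
  obtain ⟨⟨s, _⟩, hs, hr, rfl⟩ := h
  obtain ⟨hs0, k, hk, hk'⟩ := rankLE_draw_of_mem_ranked _ hs i (by simp)
  simp only [Multiset.erase_cons_head] at hs0 hr hk hk'
  exact ⟨r - 1, by omega, k, hk.mono (by omega), hk'⟩

/-- The process is the network with components whose rank is at most `r`. -/
def HasRank (P : Proc) (r : ℕ) : Prop := ∃ m, RankLE r m ∧ Net P m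

/-- The groups of a process of rank at most `r`: a single transition that is not a draw and does
not increase the rank, or a draw whose results have rank at most `r - 1` and `1`. -/
inductive RankedGroup : ℕ → PMF (Act × Proc) → Prop
  | quiet {r μ P} : (∀ d, μ ≠ Act.tau (some d)) → HasRank P r → RankedGroup r (PMF.pure (μ, P))
  | draw {r i k} {P : Fin 2 → Proc} : HasRank (P k) r → HasRank (P (k + 1)) 1 →
      RankedGroup (r + 1)
        ((PMF.uniformOfFintype (Fin 2)).map fun k => (Act.tau (some (i, i + k)), P k))

theorem HasRank.rankedGroup {P : Proc} {r : ℕ} {g : PMF (Act × Proc)} (hP : HasRank P r)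
    (hs : Step ∅ P g) : RankedGroup r g := by
  obtain ⟨m, hm, hP⟩ := hP
  cases hP.internalGroup hs with
  | msg _ _ h => exact .quiet (fun _ => Act.noConfusion) ⟨m, hm, h⟩
  | silent hsil h => exact .quiet (fun _ => by simp) ⟨_, hsil.rankLE hm, h⟩
  | draw h =>
    obtain ⟨r, rfl, k, hk, hk'⟩ := hm.draw
    exact .draw ⟨_, hk, h k⟩ ⟨_, hk', h (k + 1)⟩

theorem hasRank_network : HasRank network 2 :=
  ⟨_, by decide +kernel, net_network⟩

end Election

/-! ## Executions -/

theorem map_prodMap_compProd_comap {α β γ : Type*} [MeasurableSpace α] [MeasurableSpace β]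
    [MeasurableSpace γ] (μ : Measure α) [SFinite μ] (κ : Kernel β γ) [IsSFiniteKernel κ]
    {f : α → β} (hf : Measurable f) :
    (μ ⊗ₘ κ.comap f hf).map (Prod.map f id) = μ.map f ⊗ₘ κ := by
  ext s hs
  have hfid : Measurable (Prod.map f (id : γ → γ)) := hf.prodMap measurable_id
  rw [Measure.map_apply hfid hs, Measure.compProd_apply (hfid hs), Measure.compProd_apply hs,
    lintegral_map (Kernel.measurable_kernel_prodMk_left hs) hf]
  rfl

namespace ProbAutomaton.Adversary

variable {S A : Type} {M : ProbAutomaton S A}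

/-- The choice of the next node, as a kernel on the nodes: the executions are a homogeneous Markov
chain on the unfolding tree. -/
noncomputable def nextKernel (ζ : M.Adversary) : Kernel (Node S A) (Node S A) :=
  ⟨fun n => (ζ.next n).toMeasure, measurable_from_top⟩

instance (ζ : M.Adversary) : IsMarkovKernel ζ.nextKernel :=
  ⟨fun n => PMF.toMeasure.isProbabilityMeasure (ζ.next n)⟩

instance (ζ : M.Adversary) : IsProbabilityMeasure ζ.execMeasure :=
  inferInstanceAs (IsProbabilityMeasure (Kernel.traj (X := fun _ => Node S A) ζ.stepKernel 0 _))

theorem execMeasure_map_zero (ζ : M.Adversary) :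
    ζ.execMeasure.map (fun ω => ω 0) = Measure.dirac Node.root := by
  let first : (Finset.Iic 0 → Node S A) → Node S A := fun u => u ⟨0, Finset.mem_Iic.2 le_rfl⟩
  have hfirst : Measurable first := measurable_pi_apply _
  have hrestrict := Preorder.measurable_frestrictLe (X := fun _ => Node S A) 0
  calc
    ζ.execMeasure.map (fun ω => ω 0) = (ζ.execMeasure.map (Preorder.frestrictLe 0)).map first :=
      (Measure.map_map hfirst hrestrict).symm
    _ = (Measure.dirac fun _ => Node.root).map first := by
      rw [execMeasure, Kernel.traj_map_frestrictLe_apply, Kernel.partialTraj_self, Kernel.id_apply]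
    _ = Measure.dirac Node.root := Measure.map_dirac' hfirst _

theorem execMeasure_map_succ (ζ : M.Adversary) (t : ℕ) :
    ζ.execMeasure.map (fun ω => (ω t, ω (t + 1))) =
      (ζ.execMeasure.map fun ω => ω t) ⊗ₘ ζ.nextKernel := by
  let last : (Finset.Iic t → Node S A) → Node S A := fun u => u ⟨t, Finset.mem_Iic.2 le_rfl⟩
  have hlast : Measurable last := measurable_pi_apply _
  have hrestrict := Preorder.measurable_frestrictLe (X := fun _ => Node S A) t
  have hstep : (ζ.execMeasure.map (Preorder.frestrictLe t)) ⊗ₘ ζ.nextKernel.comap last hlast =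
      ζ.execMeasure.map (fun ω => (Preorder.frestrictLe t ω, ω (t + 1))) := by
    rw [execMeasure, Kernel.traj_map_frestrictLe_apply]
    exact Kernel.partialTraj_compProd_eq_map_traj (X := fun _ => Node S A) t.zero_le
  calc
    ζ.execMeasure.map (fun ω => (ω t, ω (t + 1))) =
        (ζ.execMeasure.map fun ω => (Preorder.frestrictLe t ω, ω (t + 1))).map
          (Prod.map last id) :=
      (Measure.map_map (hlast.prodMap measurable_id)
        (hrestrict.prodMk (measurable_pi_apply (t + 1)))).symm
    _ = ((ζ.execMeasure.map (Preorder.frestrictLe t)).map last) ⊗ₘ ζ.nextKernel := by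
      rw [← hstep, map_prodMap_compProd_comap]
    _ = (ζ.execMeasure.map fun ω => ω t) ⊗ₘ ζ.nextKernel := by
      rw [Measure.map_map hlast hrestrict]
      rfl

theorem lintegral_execMeasure_le (ζ : M.Adversary) {V : Node S A → ℝ≥0∞}
    (hV : ∀ n, ∫⁻ y, V y ∂(ζ.next n).toMeasure ≤ V n) (t : ℕ) :
    ∫⁻ ω, V (ω t) ∂ζ.execMeasure ≤ V Node.root := by
  have hVm : Measurable V := measurable_from_top
  induction t with
  | zero =>
    rw [← lintegral_map hVm (measurable_pi_apply 0), execMeasure_map_zero, lintegral_dirac]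
  | succ t ih =>
    calc
      ∫⁻ ω, V (ω (t + 1)) ∂ζ.execMeasure =
          ∫⁻ p, V p.2 ∂ζ.execMeasure.map (fun ω => (ω t, ω (t + 1))) := by
        rw [lintegral_map (by fun_prop) (by fun_prop)]
      _ = ∫⁻ ω, ∫⁻ y, V y ∂(ζ.next (ω t)).toMeasure ∂ζ.execMeasure := by
        rw [execMeasure_map_succ, Measure.lintegral_compProd (by fun_prop),
          lintegral_map measurable_from_top (measurable_pi_apply t)]
        rfl
      _ ≤ ∫⁻ ω, V (ω t) ∂ζ.execMeasure := lintegral_mono fun ω => hV (ω t)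
      _ ≤ V Node.root := ih

theorem ae_monotone (ζ : M.Adversary) {d : Node S A → ℕ}
    (hd : ∀ n, ∀ y ∈ (ζ.next n).support, d n ≤ d y) :
    ∀ᵐ ω ∂ζ.execMeasure, Monotone fun t => d (ω t) := by
  have hdm : Measurable d := measurable_from_top
  have hsucc (t : ℕ) : ∀ᵐ ω ∂ζ.execMeasure, d (ω t) ≤ d (ω (t + 1)) := by
    have hpair : ∀ᵐ p ∂ζ.execMeasure.map (fun ω => (ω t, ω (t + 1))), d p.1 ≤ d p.2 := by
      rw [execMeasure_map_succ,
        Measure.ae_compProd_iff (measurableSet_le (by fun_prop) (by fun_prop))]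
      refine .of_forall fun n => (PMF.toMeasure_apply_eq_zero_iff _ .of_discrete).2 ?_
      exact Set.disjoint_left.2 fun y hy hlt => hlt (hd n y hy)
    exact ae_of_ae_map (by fun_prop) hpair
  filter_upwards [ae_all_iff.2 hsucc] with ω hω
  exact monotone_nat_of_le_succ hω

theorem execMeasure_exists_le (ζ : M.Adversary) {d : Node S A → ℕ} {V : Node S A → ℝ≥0∞} {n : ℕ}
    (hd : ∀ n, ∀ y ∈ (ζ.next n).support, d n ≤ d y)
    (hV : ∀ n, ∫⁻ y, V y ∂(ζ.next n).toMeasure ≤ V n) (hdV : ∀ y, n ≤ d y → 1 ≤ V y) :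
    ζ.execMeasure {ω | ∃ t, n ≤ d (ω t)} ≤ V Node.root := by
  have hVm : Measurable V := measurable_from_top
  let reached (t : ℕ) : Set (ℕ → Node S A) := {ω | ∃ s ≤ t, n ≤ d (ω s)}
  have hreached (t : ℕ) : ζ.execMeasure (reached t) ≤ V Node.root := by
    calc
      ζ.execMeasure (reached t) ≤ ζ.execMeasure {ω | 1 ≤ V (ω t)} := by
        refine measure_mono_ae ?_
        filter_upwards [ζ.ae_monotone hd] with ω hω ⟨s, hs, hn⟩
        exact hdV _ (hn.trans (hω hs))
      _ ≤ ∫⁻ ω, V (ω t) ∂ζ.execMeasure := by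
        simpa only [one_mul] using mul_meas_ge_le_lintegral (μ := ζ.execMeasure)
          (f := fun ω => V (ω t)) (by fun_prop) 1
      _ ≤ V Node.root := ζ.lintegral_execMeasure_le hV t
  have hmono : Monotone reached := fun a b hab ω ⟨s, hs, hn⟩ => ⟨s, hs.trans hab, hn⟩
  have hunion : {ω : ℕ → Node S A | ∃ t, n ≤ d (ω t)} = ⋃ t, reached t := by
    ext ω
    simp only [reached, Set.mem_iUnion, Set.mem_ofPred_eq]
    exact ⟨fun ⟨t, h⟩ => ⟨t, t, le_rfl, h⟩, fun ⟨_, s, _, h⟩ => ⟨s, h⟩⟩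
  rw [hunion, hmono.measure_iUnion]
  exact iSup_le hreached

end ProbAutomaton.Adversary

/-! ## The bound -/

theorem lintegral_uniform_fin_two {α : Type*} [MeasurableSpace α] {V : α → ℝ≥0∞}
    (hV : Measurable V) (f : Fin 2 → α) (k : Fin 2) :
    ∫⁻ y, V y ∂((PMF.uniformOfFintype (Fin 2)).map f).toMeasure =
      2⁻¹ * (V (f k) + V (f (k + 1))) := by
  have hsum : V (f k) + V (f (k + 1)) = ∑ j, V (f j) := by
    fin_cases k <;> simp [Fin.sum_univ_two, add_comm]
  rw [← PMF.toMeasure_map (f := f) _ measurable_from_top, lintegral_map hV measurable_from_top,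
    lintegral_fintype, hsum, Finset.mul_sum]
  simp only [PMF.toMeasure_apply_singleton _ _ (.singleton _), PMF.uniformOfFintype_apply,
    Fintype.card_fin, Nat.cast_ofNat, mul_comm]

namespace Election

open Proc

/-- A bound on the probability of at least `k` further draws from a process of rank `r`. -/
noncomputable def drawBound : ℕ → ℕ → ℝ≥0∞
  | _, 0 => 1
  | 0, _ + 1 => 0
  | r + 1, k + 1 => 2⁻¹ ^ (k - r)

theorem drawBound_average_le (r k : ℕ) :
    2⁻¹ * (drawBound r (k - 1) + drawBound 1 (k - 1)) ≤ drawBound (r + 1) k := by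
  have hhalf (a : ℝ≥0∞) : 2⁻¹ * (a + a) = a := by
    rw [← two_mul, ← mul_assoc, ENNReal.inv_mul_cancel (by simp) (by simp), one_mul]
  rcases k with _ | _ | k
  · exact (hhalf 1).le
  · simp only [drawBound, zero_add, Nat.sub_self, Nat.zero_sub, pow_zero, hhalf, le_refl]
  cases r with
  | zero => simp only [drawBound, Nat.add_sub_cancel, Nat.sub_zero, zero_add, pow_succ', le_refl]
  | succ r =>
    calc
      2⁻¹ * (2⁻¹ ^ (k - r) + 2⁻¹ ^ k) ≤ 2⁻¹ * (2⁻¹ ^ (k - r) + 2⁻¹ ^ (k - r) : ℝ≥0∞) := by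
        gcongr 2⁻¹ * (_ + ?_)
        exact pow_le_pow_of_le_one zero_le (by simp) (k.sub_le r)
      _ = drawBound (r + 2) (k + 2) := by rw [hhalf, drawBound, Nat.add_sub_add_right]

/-- The least bound on the probability of at least `n` draws in all that a rank of the process at
the node `y` gives. -/
noncomputable def value (n : ℕ) (y : Node Proc Act) : ℝ≥0∞ :=
  ⨅ (r : ℕ) (_ : HasRank (network.automaton.state y) r), drawBound r (n - draws y)

theorem value_le {n r : ℕ} {y : Node Proc Act} (hy : HasRank (network.automaton.state y) r) :
    value n y ≤ drawBound r (n - draws y) :=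
  iInf₂_le r hy

theorem one_le_value {n : ℕ} {y : Node Proc Act} (h : n ≤ draws y) : 1 ≤ value n y := by
  refine le_iInf₂ fun r _ => ?_
  rw [Nat.sub_eq_zero_of_le h, drawBound]

theorem draws_le_child (y : Node Proc Act) (g : PMF (Act × Proc)) (μ : Act) (P : Proc) :
    draws y ≤ draws (y.child g μ P) := by
  rcases μ with _ | _ | _ | _ | _ <;> simp [draws]

theorem draws_child_of_ne {y : Node Proc Act} {g : PMF (Act × Proc)} {μ : Act} {P : Proc}
    (hμ : ∀ d, μ ≠ Act.tau (some d)) : draws (y.child g μ P) = draws y := by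
  rcases μ with _ | _ | _ | _ | d
  on_goal 5 => exact (hμ d rfl).elim
  all_goals rfl

theorem draws_le_of_mem_support_next (ζ : network.automaton.Adversary) (y y' : Node Proc Act)
    (hy' : y' ∈ (ζ.next y).support) : draws y ≤ draws y' := by
  unfold ProbAutomaton.Adversary.next at hy'
  split at hy'
  · rw [(PMF.mem_support_pure_iff _ _).1 hy']
  · obtain ⟨a, _, rfl⟩ := (PMF.mem_support_map_iff _ _ _).1 hy'
    exact draws_le_child _ _ _ _

theorem RankedGroup.lintegral_value_child_le {y : Node Proc Act} {g g' : PMF (Act × Proc)} {r : ℕ}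
    (n : ℕ) (hg : RankedGroup r g) :
    ∫⁻ y', value n y' ∂(g.map fun a => y.child g' a.1 a.2).toMeasure ≤
      drawBound r (n - draws y) := by
  cases hg with
  | quiet hμ hP =>
    rw [PMF.pure_map, PMF.toMeasure_pure, lintegral_dirac, ← draws_child_of_ne hμ]
    exact value_le hP
  | @draw r i k P hP hP' =>
    have hvalue {r' : ℕ} (d : Draw) {Q : Proc} (hQ : HasRank Q r') :
        value n (y.child g' (Act.tau (some d)) Q) ≤ drawBound r' (n - draws y - 1) :=
      value_le (y := y.child g' (Act.tau (some d)) Q) hQ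
    rw [PMF.map_comp, lintegral_uniform_fin_two measurable_from_top _ k]
    calc
      _ ≤ 2⁻¹ * (drawBound r (n - draws y - 1) + drawBound 1 (n - draws y - 1)) := by
        gcongr
        · exact hvalue _ hP
        · exact hvalue _ hP'
      _ ≤ drawBound (r + 1) (n - draws y) := drawBound_average_le r _

theorem lintegral_value_next_le (ζ : network.automaton.Adversary) (n : ℕ) (y : Node Proc Act) :
    ∫⁻ y', value n y' ∂(ζ.next y).toMeasure ≤ value n y := by
  unfold ProbAutomaton.Adversary.next
  split
  · rw [PMF.toMeasure_pure, lintegral_dirac]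
  · next g hg =>
    exact le_iInf₂ fun r hr => (hr.rankedGroup (ζ.mem_trans _ _ hg)).lintegral_value_child_le n

end Election

theorem mainTheorem3 (n : ℕ) (hn : 2 ≤ n) (ζ : Election.network.automaton.Adversary) :
    ζ.execMeasure {ω | ∃ t, n ≤ Election.draws (ω t)} ≤ 1 / 2 ^ (n - 2) := by
  obtain ⟨k, rfl⟩ := Nat.exists_eq_add_of_le' hn
  calc
    ζ.execMeasure {ω | ∃ t, k + 2 ≤ Election.draws (ω t)} ≤ Election.value (k + 2) Node.root :=
      ζ.execMeasure_exists_le (Election.draws_le_of_mem_support_next ζ)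
        (Election.lintegral_value_next_le ζ (k + 2)) fun _ => Election.one_le_value
    _ ≤ Election.drawBound 2 (k + 2) := Election.value_le (y := Node.root) Election.hasRank_network
    _ = 1 / 2 ^ (k + 2 - 2) := by
      rw [Election.drawBound, one_div, ENNReal.inv_pow, Nat.add_sub_cancel, Nat.add_sub_cancel]
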